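/- Processes are real-valued and indexed by $[0,\infty)$; Markov and martingale properties refer to the natural filtration. A process $Y$ is Markov if $\mathbb E[g(Y_t)\mid\mathcal F^Y_s]=\mathbb E[g(Y_t)\mid Y_s]$ for $s\le t$ and bounded measurable $g$. For $\kappa>0$ it is $\kappa$-self-similar if $(Y_{ct})_{t\ge0}$ and $(c^\kappa Y_t)_{t\ge 0}$ have the same finite-dimensional distributions for every $c>0$. A transition function of $Y$ is a family of probability measures $P(s,t,x,dy)$, $s\le t$, jointly measurable in $(s,t,x)$, with $P(s,t,x,dy)=\mathbb P(Y_t\in dy\mid Y_s=x)$ for almost every $x$ under the law of $Y_s$. A function $\psi$ on $[0,\infty)$ is the Laplace exponent of a subordinator if there is a càdlàg nondecreasing process $\zeta$ with $\zeta_0=0$ and independent stationary increments such that $\mathbb E[e^{-\lambda\zeta_a}]=e^{-a\psi(\lambda)}$ for all $a,\lambda\ge0$. **Theorem.** Let $\kappa>0$, let $Z$ be a càdlàg $\kappa$-self-similar Markov process, and let $\psi$ be the Laplace exponent of a subordinator. For $u\ge1$ there is a random variable $R_u$ with values in $(0,1]$ and $\mathbb E[R_u^\lambda]=u^{-\psi(\lambda)}$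 for all $\lambda\ge0$ (so $R_u$ has the law of $e^{-\zeta_{\ln u}}$), and there is a $\kappa$-self-similar Markov process $X$ with $X_0=0$, with càdlàg paths on $(0,\infty)$, and with $X_t\overset{d}{=}Z_t$ for every $t\ge0$, such that the following hold. 1. For every transition function $P$ of $Z$, a transition function of $X$ is given by $$\widetilde P(0,t,x,dy)=P(0,t,x,dy),\qquad \widetilde P(s,t,x,dy)=\mathbb E\big[P\big(R_{t/s}t,\;t,\;(t/s)^\kappa R_{t/s}^\kappa x,\;dy\big)\big]\quad(0<s\le t).$$ (At time $0$ only the state $x=0$ is relevant.) If moreover $P$ satisfies $P(s,s,x,\cdot)=\delta_x$, the Chapman–Kolmogorov equations and the scaling property $P(cs,ct,c^\kappa x,c^\kappa dy)=P(s,t,x,dy)$ for all $c>0$, all times and every $x$ (with only $x=0$ when $s=0$), then so does $\widetilde P$. 2. If $Z$ is a martingale and $\psi(\kappa)=\kappa$, then $X$ is a martingale, and $X$ is càdlàg on $[0,\infty)$. 3. The condition $\psi(\kappa)=\kappa$ is equivalent to $\mathbb E[R_{t/s}^\kappa]=(s/t)^\kappa$ for all $0<s\le t$. -/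

import Mathlib

open MeasureTheory ProbabilityTheory Filter Set
open scoped NNReal ENNReal Topology

universe u

/-- A real function of time is càdlàg at the time `t`: right-continuous with a finite left limit.
At `t = 0` the left-limit clause is void, because `𝓝[<] (0 : ℝ≥0) = ⊥`. -/
def IsCadlagAt (f : ℝ≥0 → ℝ) (t : ℝ≥0) : Prop :=
  ContinuousWithinAt f (Ici t) t ∧ ∃ l : ℝ, Tendsto f (𝓝[<] t) (𝓝 l)

/-- The natural filtration of a real-valued process indexed by `[0, ∞)`. -/
noncomputable abbrev naturalFiltration {Ω : Type u} [mΩ : MeasurableSpace Ω] (Z : ℝ≥0 → Ω → ℝ)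
    (hZ : ∀ t, Measurable (Z t)) : Filtration ℝ≥0 mΩ :=
  Filtration.natural Z fun t => (hZ t).stronglyMeasurable

/-- The Markov property with respect to the natural filtration:
`E[g(Z_t) | F_s] = E[g(Z_t) | Z_s]` for all `s ≤ t` and all bounded measurable `g`. -/
def IsMarkovProcess {Ω : Type u} [MeasurableSpace Ω] (μ : Measure Ω) (Z : ℝ≥0 → Ω → ℝ)
    (hZ : ∀ t, Measurable (Z t)) : Prop :=
  ∀ s t : ℝ≥0, s ≤ t → ∀ g : ℝ → ℝ, Measurable g → (∃ C, ∀ x, |g x| ≤ C) →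
    μ[fun ω => g (Z t ω) | naturalFiltration Z hZ s] =ᵐ[μ]
      μ[fun ω => g (Z t ω) | MeasurableSpace.comap (Z s) inferInstance]

/-- `κ`-self-similarity: for every `c > 0` the processes `(Z_{ct})` and `(c^κ Z_t)` have the same
finite-dimensional distributions. -/
def IsSelfSimilar {Ω : Type u} [MeasurableSpace Ω] (κ : ℝ) (μ : Measure Ω)
    (Z : ℝ≥0 → Ω → ℝ) : Prop :=
  ∀ c : ℝ≥0, 0 < c → ∀ I : Finset ℝ≥0,
    μ.map (fun ω (i : I) => Z (c * i) ω) = μ.map (fun ω (i : I) => (c : ℝ) ^ κ * Z i ω)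

/-- `P` is a transition function of the process `Z`: for `s ≤ t`, `P(s, t, x, ·)` is a
probability measure, it is jointly measurable in `(s, t, x)`, and
`P(s, t, x, dy) = ℙ(Z_t ∈ dy | Z_s = x)` for almost every `x` under the law of `Z_s`.
The values of `P` at `s > t` play no role. -/
structure IsTransitionFunctionOf {Ω : Type u} [MeasurableSpace Ω] (μ : Measure Ω)
    [IsFiniteMeasure μ] (Z : ℝ≥0 → Ω → ℝ) (P : ℝ≥0 → ℝ≥0 → ℝ → Measure ℝ) : Prop where
  measurable : Measurable fun p : ℝ≥0 × ℝ≥0 × ℝ => P p.1 p.2.1 p.2.2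
  isProbabilityMeasure : ∀ s t x, s ≤ t → IsProbabilityMeasure (P s t x)
  condDistrib : ∀ s t, s ≤ t →
    ∀ᵐ x ∂(μ.map (Z s)), P s t x = ProbabilityTheory.condDistrib (Z t) (Z s) μ x

/-- The identities of a transition function with the scaling property of exponent `κ`, required
at *every* state `x` (and not only almost everywhere): `P(s, s, x, ·) = δ_x`, the
Chapman--Kolmogorov equations, and `P(cs, ct, c^κ x, c^κ dy) = P(s, t, x, dy)`.
A self-similar process sits at `0` at time `0`, so at `s = 0` only the state `x = 0` occurs. -/
structure IsScalingTransitionSystem (κ : ℝ) (P : ℝ≥0 → ℝ≥0 → ℝ → Measure ℝ) : Prop where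
  refl : ∀ s x, (s = 0 → x = 0) → P s s x = Measure.dirac x
  chapman_kolmogorov : ∀ s t u x, s ≤ t → t ≤ u → (s = 0 → x = 0) →
    ∀ B, MeasurableSet B → ∫⁻ y, P t u y B ∂(P s t x) = P s u x B
  scaling : ∀ (c s t : ℝ≥0) (x : ℝ), 0 < c → s ≤ t → (s = 0 → x = 0) →
    P (c * s) (c * t) ((c : ℝ) ^ κ * x) = (P s t x).map fun y => (c : ℝ) ^ κ * y

/-- A subordinator: a càdlàg nondecreasing process started at `0` with independent and stationary
increments. -/
structure IsSubordinator {Ω : Type u} [MeasurableSpace Ω] (μ : Measure Ω)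
    (ζ : ℝ≥0 → Ω → ℝ) : Prop where
  measurable : ∀ t, Measurable (ζ t)
  zero : ∀ ω, ζ 0 ω = 0
  monotone : ∀ ω, Monotone fun t => ζ t ω
  cadlag : ∀ ω t, IsCadlagAt (fun t => ζ t ω) t
  indep : HasIndepIncrements ζ μ
  stationary : ∀ s t, μ.map (fun ω => ζ (s + t) ω - ζ s ω) = μ.map (ζ t)

/-- `ψ : [0, ∞) → ℝ` is the Laplace exponent of some subordinator `ζ`:
`E[exp (-λ ζ_a)] = exp (-a ψ(λ))` for all `a, λ ≥ 0`. (Values of `ψ` at negative arguments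
play no role.) -/
def IsLaplaceExponent (ψ : ℝ → ℝ) : Prop :=
  ∃ (Ω : Type) (_ : MeasurableSpace Ω) (μ : Measure Ω) (_ : IsProbabilityMeasure μ)
    (ζ : ℝ≥0 → Ω → ℝ), IsSubordinator μ ζ ∧
      ∀ (a : ℝ≥0) (l : ℝ), 0 ≤ l →
        ∫ ω, Real.exp (-(l * ζ a ω)) ∂μ = Real.exp (-(a * ψ l))

/-- `(G_u)_{u ≥ 1}` is the family of laws of the random variables `R_u` associated with `ψ`, i.e.
`G_u` is the law of `exp (-ζ_{log u})` for a subordinator `ζ` with Laplace exponent `ψ`: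
each `G_u` is a probability measure on `(0, 1]` and `∫ r^λ G_u(dr) = u^{-ψ(λ)}` for all `λ ≥ 0`
(these moments determine `G_u`). -/
def IsRandomisingFamily (ψ : ℝ → ℝ) (G : ℝ≥0 → Measure ℝ≥0) : Prop :=
  ∀ u : ℝ≥0, 1 ≤ u → IsProbabilityMeasure (G u) ∧ G u (Ioc 0 1)ᶜ = 0 ∧
    ∀ l : ℝ, 0 ≤ l → ∫ r : ℝ≥0, (r : ℝ) ^ l ∂(G u) = (u : ℝ) ^ (-ψ l)

/-- The randomised transition function
`P̃(s, t, x, dy) = E[P(R_{t/s} t, t, (t/s)^κ R_{t/s}^κ x, dy)]` for `0 < s ≤ t`, where `R_u` has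
law `G_u`, and `P̃(0, t, x, dy) = P(0, t, x, dy)` (only `x = 0` matters at time `0`). -/
noncomputable def randomisedTransition (κ : ℝ) (G : ℝ≥0 → Measure ℝ≥0)
    (P : ℝ≥0 → ℝ≥0 → ℝ → Measure ℝ) : ℝ≥0 → ℝ≥0 → ℝ → Measure ℝ :=
  fun s t x =>
    if s = 0 then P 0 t x
    else (G (t / s)).bind fun r => P (r * t) t (((t / s : ℝ≥0) : ℝ) ^ κ * (r : ℝ) ^ κ * x)

/-! The Lamperti transform `V_a = e^{-κa} Z_{e^a}`, `a ∈ ℝ`, turns self-similarity of `Z` into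
stationarity and keeps the Markov property. Let `η` be a two-sided version of the subordinator `ζ`,
independent of `Z`, and put `U_a = V_{η_a}`, `X_t = t^κ U_{log t}`, `X_0 = 0`. Running a stationary
Markov process along an independent clock with stationary independent increments keeps it Markov
(`lintegral_mul_subordinate`) and stationary (`map_subordinate_shift`), so `X` is a self-similar
Markov process.

The identity that carries the rest is `map_subordinate_prodMk`. With the clock frozen, stationarity
of `V` moves the later time `η_b` to any deterministic `h`, so `(U_a, U_b)` has the law of
`(V_{h-D}, V_h)` with `D` independent of `V` and distributed as `ζ_{b-a}`. For `a = log s`, `b = h =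
log t` and `R = e^{-D}` this says that `(X_s, X_t)` has the law of `(c^κ Z_{Rt}, Z_t)` with `c =
s/(Rt)`. The second coordinate gives the marginals. Given `R = r`, the process `Z` travels from time
`rt` and state `(t/s)^κ r^κ x` to time `t`, where `x` is the first coordinate; that coordinate has
the law of `Z_s` whatever `r` is, so `R` stays independent of it, and averaging over `R` gives the
randomised transition function. Its pointwise identities follow from those of `P` and from `R_u R_v
~ R_{uv}` for independent factors.

If `Z` is a martingale, conditioning on `R` gives `E[f(X_s) X_t] = E[f(c^κ Z_{Rt}) Z_{Rt}] =
E[c^{-κ}] E[f(Z_s) Z_s]`, and `E[c^{-κ}] = (t/s)^κ E[R^κ]` equals `1` when `ψ(κ) = κ`.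

For the paths, `X_t = (t/τ_t)^κ Z_{τ_t}` with `τ_t = e^{η_{log t}}` nondecreasing and
right-continuous, which is càdlàg for `t > 0`. At time `0`, `E|X_t| = t^κ E|Z_1|` tends to `0`, and
Doob's maximal inequality upgrades this to almost sure convergence in the martingale case; the
exceptional null set is then removed. -/

set_option linter.unusedSectionVars false

/-! ### Joint measurability and independence -/

/-- A right-continuous process with measurable coordinates is jointly measurable. -/
theorem measurable_uncurry_of_rightContinuous {Ω : Type*} [MeasurableSpace Ω] {Z : ℝ≥0 → Ω → ℝ}
    (hZ : ∀ t, Measurable (Z t)) (hr : ∀ ω t, ContinuousWithinAt (fun t => Z t ω) (Ici t) t) :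
    Measurable fun p : ℝ≥0 × Ω => Z p.1 p.2 := by
  -- Rounding the time up to a grid of mesh `1/(n+1)` leaves countably many times, so joint
  -- measurability is immediate; rounding up makes right-continuity suffice in the limit.
  have hmeas : ∀ n : ℕ, Measurable fun p : ℝ≥0 × Ω =>
      Z (⌈p.1 * ((n : ℝ≥0) + 1)⌉₊ / ((n : ℝ≥0) + 1)) p.2 := fun n => by
    have h : Measurable fun q : ℕ × Ω => Z (q.1 / ((n : ℝ≥0) + 1)) q.2 :=
      measurable_from_prod_countable_right fun k => hZ (k / ((n : ℝ≥0) + 1))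
    have hc : Measurable fun p : ℝ≥0 × Ω => (⌈p.1 * ((n : ℝ≥0) + 1)⌉₊, p.2) :=
      (Nat.measurable_ceil.comp (measurable_fst.mul_const _)).prodMk measurable_snd
    exact h.comp hc
  refine measurable_of_tendsto_metrizable hmeas (tendsto_pi_nhds.2 fun p => ?_)
  have hto : Tendsto (fun n : ℕ => (⌈p.1 * ((n : ℝ≥0) + 1)⌉₊ : ℝ≥0) / ((n : ℝ≥0) + 1)) atTop
      (𝓝[≥] p.1) := by
    refine tendsto_nhdsWithin_iff.2 ⟨?_, .of_forall fun n => ?_⟩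
    · have h := tendsto_nat_ceil_mul_div_atTop (R := ℝ) (a := p.1) p.1.2
      have h2 := h.comp ((tendsto_atTop_add_const_right _ (1 : ℝ)
        (tendsto_natCast_atTop_atTop (R := ℝ))))
      rw [← NNReal.tendsto_coe]
      refine h2.congr fun n => ?_
      have hc : ⌈(p.1 : ℝ) * ((n : ℝ) + 1)⌉₊ = ⌈p.1 * ((n : ℝ≥0) + 1)⌉₊ := by
        
        refine eq_of_forall_ge_iff fun k => ?_
        rw [Nat.ceil_le, Nat.ceil_le, ← NNReal.coe_le_coe]
        push_cast
        rfl
      simp [hc]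
    · have hpos : (0 : ℝ≥0) < (n : ℝ≥0) + 1 := by positivity
      exact (le_div_iff₀ hpos).2 (Nat.le_ceil _)
  exact (hr p.2 p.1).tendsto.comp hto

/-- The nonnegative function `1 - exp (-D)` has integral zero. This bounded criterion replaces
moments both for jumps of the clock at a fixed time and for `Z 0`. -/
theorem ae_eq_zero_of_integral_exp_neg {Ω : Type*} [MeasurableSpace Ω] {μ : Measure Ω}
    [IsProbabilityMeasure μ] {D : Ω → ℝ} (hD : Measurable D) (hD0 : ∀ ω, 0 ≤ D ω)
    (h : ∫ ω, Real.exp (-D ω) ∂μ = 1) : D =ᵐ[μ] 0 := by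
  have hint : Integrable (fun ω => Real.exp (-D ω)) μ :=
    Integrable.of_bound (Real.measurable_exp.comp hD.neg).aestronglyMeasurable 1
      (.of_forall fun ω => by
        rw [Real.norm_eq_abs, Real.abs_exp, Real.exp_le_one_iff, neg_nonpos]; exact hD0 ω)
  have h4 : ∫ ω, (1 - Real.exp (-D ω)) ∂μ = 0 := by
    rw [integral_sub (integrable_const _) hint, h]; simp
  have h5 := (integral_eq_zero_iff_of_nonneg (f := fun ω => 1 - Real.exp (-D ω))
    (fun ω => by simpa using hD0 ω) ((integrable_const _).sub hint)).1 h4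
  filter_upwards [h5] with ω hω
  have : Real.exp (-D ω) = 1 := by simp only [Pi.zero_apply] at hω; linarith
  rw [Real.exp_eq_one_iff] at this
  exact neg_eq_zero.1 this

/-- Independence passes to pairs living on two factors of a product space. -/
theorem indepFun_prodMk_fst_snd {Ω₁ Ω₂ α₁ α₂ β₁ β₂ : Type*} [MeasurableSpace Ω₁]
    [MeasurableSpace Ω₂] [MeasurableSpace α₁] [MeasurableSpace α₂] [MeasurableSpace β₁]
    [MeasurableSpace β₂] {μ : Measure Ω₁} {ν : Measure Ω₂} [IsProbabilityMeasure μ]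
    [IsProbabilityMeasure ν] {f₁ : Ω₁ → α₁} {g₁ : Ω₁ → β₁} {f₂ : Ω₂ → α₂} {g₂ : Ω₂ → β₂}
    (hf₁ : Measurable f₁) (hg₁ : Measurable g₁) (hf₂ : Measurable f₂) (hg₂ : Measurable g₂)
    (h₁ : IndepFun f₁ g₁ μ) (h₂ : IndepFun f₂ g₂ ν) :
    IndepFun (fun ω : Ω₁ × Ω₂ => (f₁ ω.1, f₂ ω.2)) (fun ω => (g₁ ω.1, g₂ ω.2)) (μ.prod ν) := by
  have hF : Measurable fun ω : Ω₁ × Ω₂ => (f₁ ω.1, f₂ ω.2) := by fun_prop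
  have hG : Measurable fun ω : Ω₁ × Ω₂ => (g₁ ω.1, g₂ ω.2) := by fun_prop
  rw [indepFun_iff_measure_inter_preimage_eq_mul]
  intro S T hS hT
  set φ : α₂ → ℝ≥0∞ := fun y => μ (f₁ ⁻¹' {x | (x, y) ∈ S}) with hφ
  set χ : β₂ → ℝ≥0∞ := fun y => μ (g₁ ⁻¹' {x | (x, y) ∈ T}) with hχ
  have hφm : Measurable φ := by
    have : MeasurableSet {p : Ω₁ × α₂ | (f₁ p.1, p.2) ∈ S} := by
      exact (show Measurable fun p : Ω₁ × α₂ => (f₁ p.1, p.2) by fun_prop) hS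
    exact measurable_measure_prodMk_right this
  have hχm : Measurable χ := by
    have : MeasurableSet {p : Ω₁ × β₂ | (g₁ p.1, p.2) ∈ T} := by
      exact (show Measurable fun p : Ω₁ × β₂ => (g₁ p.1, p.2) by fun_prop) hT
    exact measurable_measure_prodMk_right this
  rw [Measure.prod_apply_symm ((hF hS).inter (hG hT)), Measure.prod_apply_symm (hF hS),
    Measure.prod_apply_symm (hG hT)]
  -- On each slice of the second coordinate, `h₁` factorises the measure; `h₂` then factorises the
  -- integral over the slices.
  have key : ∀ y, μ ((fun x => (x, y)) ⁻¹' ((fun ω : Ω₁ × Ω₂ => (f₁ ω.1, f₂ ω.2)) ⁻¹' S ∩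
      (fun ω => (g₁ ω.1, g₂ ω.2)) ⁻¹' T)) = φ (f₂ y) * χ (g₂ y) := fun y =>
    (indepFun_iff_measure_inter_preimage_eq_mul.1 h₁ {x | (x, f₂ y) ∈ S} {x | (x, g₂ y) ∈ T}
      (measurable_prodMk_right hS) (measurable_prodMk_right hT))
  simp_rw [key]
  exact lintegral_mul_eq_lintegral_mul_lintegral_of_indepFun''
    (hφm.comp hf₂).aemeasurable (hχm.comp hg₂).aemeasurable (h₂.comp hφm hχm)

/-- For a process with independent increments, the increments before `a` and those after `a` form
independent processes. -/
theorem HasIndepIncrements.indepFun_past_future {T Ω : Type*} [LinearOrder T] [MeasurableSpace Ω]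
    {μ : Measure Ω} [IsProbabilityMeasure μ] {ζ : T → Ω → ℝ} (hm : ∀ t, Measurable (ζ t))
    (h : HasIndepIncrements ζ μ) (a : T) :
    IndepFun (fun ω (c : Iic a) => ζ c ω - ζ a ω) (fun ω (c : Ici a) => ζ c ω - ζ a ω) μ := by
  classical
  refine IndepFun.process_indepFun_process (fun c => (hm _).sub (hm _))
    (fun c => (hm _).sub (hm _)) fun I J => ?_
  set S : Finset T := insert a (I.image Subtype.val ∪ J.image Subtype.val) with hS
  have haS : a ∈ S := by simp [hS]
  have hcard : 0 < S.card := Finset.card_pos.2 ⟨a, haS⟩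
  obtain ⟨n, hn⟩ : ∃ n, n = S.card := ⟨_, rfl⟩
  -- The sorted times of `S`, continued constantly past the last index so that `t` is monotone on
  -- all of `ℕ`. With `t N = a`, past and future become sums over the disjoint blocks `i < N` and `N
  -- ≤ i < n` of increments.
  set t : ℕ → T := fun i => S.orderEmbOfFin hn.symm ⟨min i (n - 1), by omega⟩ with ht
  have htm : Monotone t := fun i j hij => (S.orderEmbOfFin hn.symm).monotone (by
    simp only [Fin.mk_le_mk]; omega)
  have hex : ∀ c ∈ S, ∃ k, k < n ∧ t k = c := by
    intro c hc
    have : c ∈ range (S.orderEmbOfFin hn.symm) := by rw [Finset.range_orderEmbOfFin]; exact hc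
    obtain ⟨k, hk⟩ := this
    refine ⟨k, k.2, ?_⟩
    rw [← hk]
    simp only [ht]
    congr 1
    ext
    simp only
    omega
  obtain ⟨N, hN, hNa⟩ := hex a haS
  obtain ⟨kI, hkI⟩ : ∃ k : I → ℕ, ∀ c, k c ≤ N ∧ t (k c) = c := by
    refine Classical.skolem (p := fun (c : I) k => k ≤ N ∧ t k = c).1 ?_
    intro c
    obtain ⟨k, hk, hkc⟩ := hex c (Finset.mem_insert_of_mem (Finset.mem_union_left _
      (Finset.mem_image_of_mem _ c.2)))
    refine ⟨min k N, min_le_right _ _, ?_⟩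
    rcases le_total k N with hkN | hkN
    · rw [min_eq_left hkN, hkc]
    · rw [min_eq_right hkN, hNa]
      have hle := htm hkN
      rw [hNa, hkc] at hle
      exact le_antisymm hle c.1.2
  obtain ⟨kJ, hkJ⟩ : ∃ k : J → ℕ, ∀ c, N ≤ k c ∧ k c < n ∧ t (k c) = c := by
    refine Classical.skolem (p := fun (c : J) k => N ≤ k ∧ k < n ∧ t k = c).1 ?_
    intro c
    obtain ⟨k, hk, hkc⟩ := hex c (Finset.mem_insert_of_mem (Finset.mem_union_right _
      (Finset.mem_image_of_mem _ c.2)))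
    refine ⟨max k N, le_max_right _ _, max_lt hk hN, ?_⟩
    rcases le_total k N with hkN | hkN
    · rw [max_eq_right hkN, hNa]
      have hle := htm hkN
      rw [hNa, hkc] at hle
      exact le_antisymm c.1.2 hle
    · rw [max_eq_left hkN, hkc]
  have hind := (h.nat htm).indepFun_finset (Finset.range N) (Finset.Ico N n)
    (by rw [Finset.disjoint_left]; intro x; simp; omega) (fun i => (hm _).sub (hm _))
  -- Extension by `0`, which lets the telescoping sums run over intervals of `ℕ`; the default is
  -- never read there.
  let e : ∀ A : Finset ℕ, (A → ℝ) → ℕ → ℝ := fun A x i => if h : i ∈ A then x ⟨i, h⟩ else 0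
  have he : ∀ A i, Measurable fun x => e A x i := by
    intro A i
    by_cases hi : i ∈ A
    · simpa [e, hi] using measurable_pi_apply (X := fun _ : A => ℝ) (⟨i, hi⟩ : A)
    · simp [e, hi]
  have hcomp := hind.comp
    (φ := fun x (c : I) => -∑ i ∈ Finset.Ico (kI c) N, e (Finset.range N) x i)
    (ψ := fun x (c : J) => ∑ i ∈ Finset.Ico N (kJ c), e (Finset.Ico N n) x i)
    (measurable_pi_lambda _ fun c => (Finset.measurable_sum _ fun i _ => he _ i).neg)
    (measurable_pi_lambda _ fun c => Finset.measurable_sum _ fun i _ => he _ i)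
  convert hcomp using 1
  · funext ω c
    have : ∀ i ∈ Finset.Ico (kI c) N,
        e (Finset.range N) (fun i => ζ (t (i + 1)) ω - ζ (t i) ω) i
          = ζ (t (i + 1)) ω - ζ (t i) ω := by
      intro i hi
      have : i ∈ Finset.range N := by simp at hi ⊢; omega
      simp only [e, dif_pos this]
    simp only [Function.comp]
    rw [Finset.sum_congr rfl this, Finset.sum_Ico_sub (fun i => ζ (t i) ω) (hkI c).1, (hkI c).2, hNa]
    ring
  · funext ω c
    have : ∀ i ∈ Finset.Ico N (kJ c),
        e (Finset.Ico N n) (fun i => ζ (t (i + 1)) ω - ζ (t i) ω) i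
          = ζ (t (i + 1)) ω - ζ (t i) ω := by
      intro i hi
      have : i ∈ Finset.Ico N n := by have := (hkJ c).2.1; simp at hi ⊢; omega
      simp only [e, dif_pos this]
    simp only [Function.comp]
    rw [Finset.sum_congr rfl this, Finset.sum_Ico_sub (fun i => ζ (t i) ω) (hkJ c).1, (hkJ c).2.2, hNa]

/-! ### Extending a subordinator to the time set `ℝ` -/

namespace IsSubordinator

variable {Ω₁ : Type*} [MeasurableSpace Ω₁] {ν : Measure Ω₁} [IsProbabilityMeasure ν]
  {ζ : ℝ≥0 → Ω₁ → ℝ}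

theorem map_sub (h : IsSubordinator ν ζ) {s t : ℝ≥0} (hst : s ≤ t) :
    ν.map (fun ω => ζ t ω - ζ s ω) = ν.map (ζ (t - s)) := by
  have := h.stationary s (t - s)
  rwa [add_tsub_cancel_of_le hst] at this

theorem conv_map (h : IsSubordinator ν ζ) (s t : ℝ≥0) :
    ν.map (ζ s) ∗ ν.map (ζ t) = ν.map (ζ (s + t)) := by
  have hi := h.indep.indepFun_eval_sub bot_le (le_self_add : s ≤ s + t)
    (.of_forall h.zero)
  have := hi.map_add_eq_map_conv_map (h.measurable _) ((h.measurable _).sub (h.measurable _))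
  rw [add_sub_cancel] at this
  rw [this]
  congr 1
  exact (h.stationary s t).symm

theorem measurable_uncurry (h : IsSubordinator ν ζ) :
    Measurable fun p : ℝ≥0 × Ω₁ => ζ p.1 p.2 :=
  measurable_uncurry_of_rightContinuous h.measurable fun ω t => (h.cadlag ω t).1

end IsSubordinator

/-- The process on `ℝ` made of a process `ζ` and the reflection of an independent copy of it. -/
def gluedProcess {Ω₁ : Type*} (ζ : ℝ≥0 → Ω₁ → ℝ) (a : ℝ) (ω : Ω₁ × Ω₁) : ℝ :=
  ζ a.toNNReal ω.1 - ζ (-a).toNNReal ω.2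

/-- The right-continuous version of `gluedProcess`. -/
noncomputable def twoSided {Ω₁ : Type*} (ζ : ℝ≥0 → Ω₁ → ℝ) (a : ℝ) (ω : Ω₁ × Ω₁) : ℝ :=
  Function.rightLim (fun x => gluedProcess ζ x ω) a

namespace IsSubordinator

variable {Ω₁ : Type*} [MeasurableSpace Ω₁] {ν : Measure Ω₁} [IsProbabilityMeasure ν]
  {ζ : ℝ≥0 → Ω₁ → ℝ}

theorem measurable_glued (h : IsSubordinator ν ζ) (a : ℝ) : Measurable (gluedProcess ζ a) :=
  ((h.measurable _).comp measurable_fst).sub ((h.measurable _).comp measurable_snd)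

theorem monotone_glued (h : IsSubordinator ν ζ) (ω : Ω₁ × Ω₁) :
    Monotone fun a => gluedProcess ζ a ω := fun _ _ hab =>
  sub_le_sub (h.monotone _ (Real.toNNReal_mono hab))
    (h.monotone _ (Real.toNNReal_mono (neg_le_neg hab)))

/-- The positive part of `[a, b]` is read on the first copy and its negative part, reflected, on the
second. The two increments are independent and their lengths add up to `b - a`, so `conv_map`
applies. -/
theorem map_glued_sub (h : IsSubordinator ν ζ) {a b : ℝ} (hab : a ≤ b) :
    (ν.prod ν).map (fun ω => gluedProcess ζ b ω - gluedProcess ζ a ω)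
      = ν.map (ζ (b - a).toNNReal) := by
  have h1 : a.toNNReal ≤ b.toNNReal := Real.toNNReal_mono hab
  have h2 : (-b).toNNReal ≤ (-a).toNNReal := Real.toNNReal_mono (neg_le_neg hab)
  have hsum : (b.toNNReal - a.toNNReal) + ((-a).toNNReal - (-b).toNNReal) = (b - a).toNNReal := by
    ext
    push_cast [NNReal.coe_sub h1, NNReal.coe_sub h2]
    simp only [Real.coe_toNNReal']
    rcases le_total 0 a with ha | ha <;> rcases le_total 0 b with hb | hb <;>
      simp [ha, hb, hab] <;> linarith
  have hm : ∀ s t, Measurable fun ω => ζ s ω - ζ t ω := fun s t =>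
    (h.measurable _).sub (h.measurable _)
  rw [← hsum, ← h.conv_map, ← h.map_sub h1, ← h.map_sub h2, Measure.conv,
    Measure.map_prod_map _ _ (hm _ _) (hm _ _),
    Measure.map_map (by fun_prop) ((hm _ _).prodMap (hm _ _))]
  congr 1
  funext ω
  simp only [gluedProcess, Function.comp, Prod.map]
  ring

/-- On the first copy the past of `a` stays in the past; on the second, reflection turns it into the
future. Independence of past and future within each copy therefore combines, with the roles swapped
on the second. -/
theorem indepFun_glued (h : IsSubordinator ν ζ) {a b : ℝ} (hab : a ≤ b) :
    IndepFun (fun ω (c : Iic a) => gluedProcess ζ c ω - gluedProcess ζ a ω)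
      (fun ω => gluedProcess ζ b ω - gluedProcess ζ a ω) (ν.prod ν) := by
  have h1 : a.toNNReal ≤ b.toNNReal := Real.toNNReal_mono hab
  have h2 : (-b).toNNReal ≤ (-a).toNNReal := Real.toNNReal_mono (neg_le_neg hab)
  have i1 := HasIndepIncrements.indepFun_past_future h.measurable h.indep a.toNNReal
  have i2 := (HasIndepIncrements.indepFun_past_future h.measurable h.indep (-a).toNNReal).symm
  have hm : ∀ s t, Measurable fun ω => ζ s ω - ζ t ω := fun s t =>
    (h.measurable _).sub (h.measurable _)
  have j1 := i1.comp (φ := id) (ψ := fun x => x ⟨b.toNNReal, h1⟩) measurable_id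
    (measurable_pi_apply (X := fun _ : Ici a.toNNReal => ℝ) _)
  have j2 := i2.comp (φ := id) (ψ := fun x => x ⟨(-b).toNNReal, h2⟩) measurable_id
    (measurable_pi_apply (X := fun _ : Iic (-a).toNNReal => ℝ) _)
  have key := indepFun_prodMk_fst_snd
    (measurable_id.comp (measurable_pi_lambda _ fun _ => hm _ _))
    ((measurable_pi_apply _).comp (measurable_pi_lambda _ fun _ => hm _ _))
    (measurable_id.comp (measurable_pi_lambda _ fun _ => hm _ _))
    ((measurable_pi_apply _).comp (measurable_pi_lambda _ fun _ => hm _ _)) j1 j2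
  have := key.comp
    (φ := fun p (c : Iic a) =>
      p.1 ⟨(c : ℝ).toNNReal, Real.toNNReal_mono c.2⟩
        - p.2 ⟨(-(c : ℝ)).toNNReal, Real.toNNReal_mono (neg_le_neg c.2)⟩)
    (ψ := fun p : ℝ × ℝ => p.1 - p.2)
    (measurable_pi_lambda _ fun c => by fun_prop) (by fun_prop)
  convert this using 1
  · funext ω c
    simp only [gluedProcess, Function.comp, id]
    ring
  · funext ω
    simp only [gluedProcess, Function.comp]
    ring

theorem tendsto_glued_nat (h : IsSubordinator ν ζ) (a : ℝ) (ω : Ω₁ × Ω₁) :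
    Tendsto (fun n : ℕ => gluedProcess ζ (a + 1 / ((n : ℝ) + 1)) ω) atTop
      (𝓝 (twoSided ζ a ω)) := by
  refine ((h.monotone_glued ω).tendsto_rightLim a).comp (tendsto_nhdsWithin_iff.2 ⟨?_, ?_⟩)
  · simpa using (tendsto_const_nhds (x := a)).add (tendsto_one_div_add_atTop_nhds_zero_nat (𝕜 := ℝ))
  · exact .of_forall fun n => by simp only [mem_Ioi, lt_add_iff_pos_right]; positivity

theorem measurable_twoSided (h : IsSubordinator ν ζ) (a : ℝ) : Measurable (twoSided ζ a) :=
  measurable_of_tendsto_metrizable (fun _ => h.measurable_glued _)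
    (tendsto_pi_nhds.2 fun ω => h.tendsto_glued_nat a ω)

theorem monotone_twoSided (h : IsSubordinator ν ζ) (ω : Ω₁ × Ω₁) :
    Monotone fun a => twoSided ζ a ω :=
  (h.monotone_glued ω).rightLim

theorem rightContinuous_twoSided (h : IsSubordinator ν ζ) (ω : Ω₁ × Ω₁) (a : ℝ) :
    ContinuousWithinAt (fun a => twoSided ζ a ω) (Ici a) a :=
  (h.monotone_glued ω).stieltjesFunction.right_continuous a

/-- For `a < 0` the reflected copy is only left-continuous, which is why right limits are taken. At
a fixed `a` this changes nothing almost surely: the increment over `[a, a + 1/(n+1)]` is distributed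
as `ζ` at `1/(n+1)`, which tends to `0`. -/
theorem twoSided_ae_eq (h : IsSubordinator ν ζ) (a : ℝ) :
    gluedProcess ζ a =ᵐ[ν.prod ν] twoSided ζ a := by
  set D : Ω₁ × Ω₁ → ℝ := fun ω => twoSided ζ a ω - gluedProcess ζ a ω
  have hD : Measurable D := (h.measurable_twoSided a).sub (h.measurable_glued a)
  have hD0 : ∀ ω, 0 ≤ D ω := fun ω => sub_nonneg.2 ((h.monotone_glued ω).le_rightLim le_rfl)
  have hpos : ∀ n : ℕ, (0 : ℝ) < 1 / ((n : ℝ) + 1) := fun n => by positivity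
  have h1 : Tendsto (fun n : ℕ => ∫ ω, Real.exp (-(gluedProcess ζ (a + 1 / ((n : ℝ) + 1)) ω
      - gluedProcess ζ a ω)) ∂(ν.prod ν)) atTop (𝓝 (∫ ω, Real.exp (-D ω) ∂(ν.prod ν))) := by
    refine tendsto_integral_of_dominated_convergence (fun _ => 1) (fun n => ?_)
      (integrable_const _) (fun n => .of_forall fun ω => ?_) (.of_forall fun ω => ?_)
    · exact (Real.measurable_exp.comp
        ((h.measurable_glued _).sub (h.measurable_glued _)).neg).aestronglyMeasurable
    · rw [Real.norm_eq_abs, Real.abs_exp, Real.exp_le_one_iff, neg_nonpos, sub_nonneg]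
      exact h.monotone_glued ω (by have := hpos n; linarith)
    · exact (Real.continuous_exp.tendsto _).comp
        (((h.tendsto_glued_nat a ω).sub_const _).neg)
  have h2 : Tendsto (fun n : ℕ => ∫ ω, Real.exp (-(ζ (1 / ((n : ℝ) + 1)).toNNReal ω)) ∂ν) atTop
      (𝓝 (∫ _, Real.exp (-0) ∂ν)) := by
    refine tendsto_integral_of_dominated_convergence (fun _ => 1) (fun n => ?_)
      (integrable_const _) (fun n => .of_forall fun ω => ?_) (.of_forall fun ω => ?_)
    · exact (Real.measurable_exp.comp (h.measurable _).neg).aestronglyMeasurable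
    · rw [Real.norm_eq_abs, Real.abs_exp, Real.exp_le_one_iff, neg_nonpos]
      exact (h.zero ω).symm.le.trans (h.monotone ω bot_le)
    · refine (Real.continuous_exp.tendsto _).comp (Tendsto.neg ?_)
      have hc := (h.cadlag ω 0).1.tendsto
      rw [h.zero] at hc
      refine hc.comp (tendsto_nhdsWithin_iff.2 ⟨?_, .of_forall fun n => mem_Ici.2 bot_le⟩)
      have := (continuous_real_toNNReal.tendsto 0).comp
        (tendsto_one_div_add_atTop_nhds_zero_nat (𝕜 := ℝ))
      simpa [Function.comp_def] using this
  have heq : ∀ n : ℕ, ∫ ω, Real.exp (-(gluedProcess ζ (a + 1 / ((n : ℝ) + 1)) ω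
      - gluedProcess ζ a ω)) ∂(ν.prod ν)
        = ∫ ω, Real.exp (-(ζ (1 / ((n : ℝ) + 1)).toNNReal ω)) ∂ν := by
    intro n
    have hmap := h.map_glued_sub (a := a) (b := a + 1 / ((n : ℝ) + 1))
      (by have := hpos n; linarith)
    rw [add_sub_cancel_left] at hmap
    have hs : AEStronglyMeasurable (fun x : ℝ => Real.exp (-x))
        (ν.map (ζ (1 / ((n : ℝ) + 1)).toNNReal)) :=
      (by fun_prop : Measurable fun x : ℝ => Real.exp (-x)).aestronglyMeasurable
    rw [← integral_map (φ := ζ (1 / ((n : ℝ) + 1)).toNNReal) (f := fun x : ℝ => Real.exp (-x))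
      (h.measurable _).aemeasurable hs, ← hmap,
      integral_map (φ := fun ω => gluedProcess ζ (a + 1 / ((n : ℝ) + 1)) ω - gluedProcess ζ a ω)
        ((h.measurable_glued _).sub (h.measurable_glued _)).aemeasurable (hmap ▸ hs)]
  simp_rw [heq] at h1
  have h3 := tendsto_nhds_unique h1 h2
  filter_upwards [ae_eq_zero_of_integral_exp_neg hD hD0 (h3.trans (by simp))] with ω hω
  exact (sub_eq_zero.1 hω).symm

theorem map_twoSided_sub (h : IsSubordinator ν ζ) {a b : ℝ} (hab : a ≤ b) :
    (ν.prod ν).map (fun ω => twoSided ζ b ω - twoSided ζ a ω) = ν.map (ζ (b - a).toNNReal) := by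
  rw [← h.map_glued_sub hab]
  refine Measure.map_congr ?_
  filter_upwards [h.twoSided_ae_eq a, h.twoSided_ae_eq b] with ω h1 h2
  rw [h1, h2]

theorem indepFun_twoSided (h : IsSubordinator ν ζ) {a b : ℝ} (hab : a ≤ b) :
    IndepFun (fun ω (c : Iic a) => twoSided ζ c ω - twoSided ζ a ω)
      (fun ω => twoSided ζ b ω - twoSided ζ a ω) (ν.prod ν) := by
  have := IndepFun.process_congr_left
    (X := fun (c : Iic a) ω => gluedProcess ζ c ω - gluedProcess ζ a ω)
    (h.indepFun_glued hab) (X' := fun c ω => twoSided ζ c ω - twoSided ζ a ω)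
    (fun c => (h.twoSided_ae_eq c).sub (h.twoSided_ae_eq a))
  exact this.congr .rfl ((h.twoSided_ae_eq b).sub (h.twoSided_ae_eq a))

end IsSubordinator

/-! ### Subordinating a stationary Markov process -/

/-- A jointly measurable real process on the time set `ℝ` that is stationary and Markov at time `0`
with the transition kernels `Q (d, ·)`. -/
structure IsStationaryMarkov {Ω : Type*} [MeasurableSpace Ω] (μ : Measure Ω) (V : ℝ → Ω → ℝ)
    (Q : Kernel (ℝ × ℝ) ℝ) : Prop where
  measurable : Measurable fun p : ℝ × Ω => V p.1 p.2
  stationary : ∀ h, μ.map (fun ω x => V (x + h) ω) = μ.map (fun ω x => V x ω)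
  markov : ∀ d, 0 ≤ d → ∀ F : (Iic (0 : ℝ) → ℝ) → ℝ≥0∞, Measurable F → ∀ f : ℝ → ℝ≥0∞,
    Measurable f → ∫⁻ ω, F (fun c => V c ω) * f (V d ω) ∂μ
      = ∫⁻ ω, F (fun c => V c ω) * ∫⁻ y, f y ∂Q (d, V 0 ω) ∂μ

/-- A nondecreasing process on the time set `ℝ` with independent increments, the increment over an
interval of length `d` having law `m d`. -/
structure IsTwoSidedSubordinator {Ω : Type*} [MeasurableSpace Ω] (ρ : Measure Ω) (η : ℝ → Ω → ℝ)
    (m : ℝ → Measure ℝ) : Prop where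
  measurable : ∀ a, Measurable (η a)
  monotone : ∀ ω, Monotone fun a => η a ω
  map_sub : ∀ a b, a ≤ b → ρ.map (fun ω => η b ω - η a ω) = m (b - a)
  indep : ∀ a b, a ≤ b →
    IndepFun (fun ω (c : Iic a) => η c ω - η a ω) (fun ω => η b ω - η a ω) ρ

/-- The process `V` run along the independent random clock `η`. -/
def subordinate {Ω Ω₂ : Type*} (V : ℝ → Ω → ℝ) (η : ℝ → Ω₂ → ℝ) (a : ℝ) (p : Ω × Ω₂) : ℝ :=
  V (η a p.2) p.1

section

variable {Ω Ω₂ : Type*} [MeasurableSpace Ω] [MeasurableSpace Ω₂] {μ : Measure Ω}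
  [IsProbabilityMeasure μ] {ρ : Measure Ω₂} [IsProbabilityMeasure ρ] {V : ℝ → Ω → ℝ}
  {η : ℝ → Ω₂ → ℝ} {Q : Kernel (ℝ × ℝ) ℝ} [IsMarkovKernel Q] {m : ℝ → Measure ℝ}

namespace IsStationaryMarkov

theorem measurable_apply (hV : IsStationaryMarkov μ V Q) (a : ℝ) : Measurable (V a) :=
  hV.measurable.comp measurable_prodMk_left

theorem lintegral_shift (hV : IsStationaryMarkov μ V Q) (h : ℝ) {G : (ℝ → ℝ) → ℝ≥0∞}
    (hG : Measurable G) :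
    ∫⁻ ω, G (fun x => V (x + h) ω) ∂μ = ∫⁻ ω, G (fun x => V x ω) ∂μ := by
  rw [← lintegral_map hG (measurable_pi_lambda _ fun x => hV.measurable_apply _), hV.stationary h,
    lintegral_map hG (measurable_pi_lambda _ fun x => hV.measurable_apply _)]

theorem lintegral_shift_mul (hV : IsStationaryMarkov μ V Q) {ι : Type*} (x : ι → ℝ) (r e : ℝ)
    {F : (ι → ℝ) → ℝ≥0∞} (hF : Measurable F) {f : ℝ → ℝ≥0∞} (hf : Measurable f) :
    ∫⁻ ω, F (fun c => V (x c) ω) * f (V e ω) ∂μ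
      = ∫⁻ ω, F (fun c => V (x c - r) ω) * f (V (e - r) ω) ∂μ := by
  have hG : Measurable fun z : ℝ → ℝ => F (fun c => z (x c - r)) * f (z (e - r)) := by fun_prop
  have := hV.lintegral_shift r hG
  simpa using this

/-- Stationarity carries the present time `r` to `0`, the only time at which the Markov property is
assumed. -/
theorem lintegral_mul (hV : IsStationaryMarkov μ V Q) {ι : Type*} (x : ι → ℝ) {r e : ℝ}
    (hx : ∀ c, x c ≤ r) (he : r ≤ e) {F : (ι → ℝ) → ℝ≥0∞} (hF : Measurable F) {f : ℝ → ℝ≥0∞}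
    (hf : Measurable f) :
    ∫⁻ ω, F (fun c => V (x c) ω) * f (V e ω) ∂μ
      = ∫⁻ ω, F (fun c => V (x c - r) ω) * ∫⁻ y, f y ∂Q (e - r, V 0 ω) ∂μ := by
  rw [hV.lintegral_shift_mul x r e hF hf]
  exact hV.markov (e - r) (sub_nonneg.2 he)
    (fun z => F fun c => z ⟨x c - r, sub_nonpos.2 (hx c)⟩)
    (hF.comp (measurable_pi_lambda _ fun c => measurable_pi_apply _)) f hf

end IsStationaryMarkov

namespace IsTwoSidedSubordinator

theorem isProbabilityMeasure (hη : IsTwoSidedSubordinator ρ η m) {d : ℝ} (hd : 0 ≤ d) :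
    IsProbabilityMeasure (m d) := by
  have := hη.map_sub 0 d hd
  rw [sub_zero] at this
  rw [← this]
  exact Measure.isProbabilityMeasure_map ((hη.measurable _).sub (hη.measurable _)).aemeasurable

end IsTwoSidedSubordinator

theorem measurable_subordinate (hV : IsStationaryMarkov μ V Q)
    (hη : IsTwoSidedSubordinator ρ η m) (a : ℝ) : Measurable (subordinate V η a) :=
  hV.measurable.comp (((hη.measurable a).comp measurable_snd).prodMk measurable_fst)

/-- The Markov property of a subordinated stationary Markov process. -/
theorem lintegral_mul_subordinate (hV : IsStationaryMarkov μ V Q)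
    (hη : IsTwoSidedSubordinator ρ η m) {a b : ℝ} (hab : a ≤ b) {F : (Iic a → ℝ) → ℝ≥0∞}
    (hF : Measurable F) {f : ℝ → ℝ≥0∞} (hf : Measurable f) :
    ∫⁻ p, F (fun c => subordinate V η c p) * f (subordinate V η b p) ∂(μ.prod ρ)
      = ∫⁻ p, F (fun c => subordinate V η c p)
          * ∫⁻ d, ∫⁻ y, f y ∂Q (d, subordinate V η a p) ∂m (b - a) ∂(μ.prod ρ) := by
  have := hη.isProbabilityMeasure (sub_nonneg.2 hab)
  have hU := measurable_subordinate hV hη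
  set Qf : ℝ × ℝ → ℝ≥0∞ := fun p => ∫⁻ y, f y ∂Q p
  have hQfm : Measurable Qf := hf.lintegral_kernel
  set g : ℝ → ℝ≥0∞ := fun x => ∫⁻ d, Qf (d, x) ∂m (b - a)
  have hgm : Measurable g := hQfm.lintegral_prod_left'
  have hUF : Measurable fun p => F (fun c => subordinate V η c p) :=
    hF.comp (measurable_pi_lambda _ fun c => hU c)
  -- The expectation over `V` with the clock frozen and recentred at its value at `a`: the first
  -- argument holds the past increments of the clock, the second its next increment.
  set Φ : (Iic a → ℝ) × ℝ → ℝ≥0∞ :=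
    fun w => ∫⁻ ω, F (fun c => V (w.1 c) ω) * Qf (w.2, V 0 ω) ∂μ with hΦ
  have hjoint : Measurable fun q : ((Iic a → ℝ) × ℝ) × Ω =>
      F (fun c => V (q.1.1 c) q.2) * Qf (q.1.2, V 0 q.2) := by
    refine (hF.comp (measurable_pi_lambda _ fun c => ?_)).mul (hQfm.comp ?_)
    · have : Measurable fun q : ((Iic a → ℝ) × ℝ) × Ω => (q.1.1 c, q.2) := by fun_prop
      exact hV.measurable.comp this
    · exact (measurable_snd.comp measurable_fst).prodMk
        ((hV.measurable_apply 0).comp measurable_snd)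
  have hΦm : Measurable Φ := hjoint.lintegral_prod_right'
  have hWm : Measurable fun ω (c : Iic a) => η c ω - η a ω :=
    measurable_pi_lambda _ fun c => (hη.measurable _).sub (hη.measurable _)
  have hDm : Measurable fun ω => η b ω - η a ω := (hη.measurable _).sub (hη.measurable _)
  have hlaw := (indepFun_iff_map_prod_eq_prod_map_map hWm.aemeasurable hDm.aemeasurable).1
    (hη.indep a b hab)
  rw [hη.map_sub a b hab] at hlaw
  rw [lintegral_prod_symm (fun p => F (fun c => subordinate V η c p) * f (subordinate V η b p))
      (hUF.mul (hf.comp (hU b))).aemeasurable,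
    lintegral_prod_symm (fun p => F (fun c => subordinate V η c p)
      * ∫⁻ d, ∫⁻ y, f y ∂Q (d, subordinate V η a p) ∂m (b - a))
      (hUF.mul (hgm.comp (hU a))).aemeasurable]
  have e1 : ∀ ω', ∫⁻ ω, F (fun c => subordinate V η c (ω, ω')) * f (subordinate V η b (ω, ω')) ∂μ
      = Φ (fun c => η c ω' - η a ω', η b ω' - η a ω') := fun ω' =>
    hV.lintegral_mul (fun c : Iic a => η c ω') (fun c => hη.monotone ω' c.2)
      (hη.monotone ω' hab) hF hf
  -- Here the next increment is a fresh draw from `m (b - a)`, whereas `e1` has the true one.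
  -- Independence of the past and the next increment of the clock (`hlaw`) makes the two integrals
  -- equal.
  have e2 : ∀ ω', ∫⁻ ω, F (fun c => subordinate V η c (ω, ω'))
      * ∫⁻ d, ∫⁻ y, f y ∂Q (d, subordinate V η a (ω, ω')) ∂m (b - a) ∂μ
      = ∫⁻ d, Φ (fun c => η c ω' - η a ω', d) ∂m (b - a) := by
    intro ω'
    have h := hV.lintegral_shift_mul (fun c : Iic a => η c ω') (η a ω') (η a ω') hF hgm
    simp only [sub_self] at h
    refine h.trans ?_
    have hj : Measurable fun q : ℝ × Ω => F (fun c : Iic a => V (η c ω' - η a ω') q.2)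
        * Qf (q.1, V 0 q.2) :=
      hjoint.comp (f := fun q : ℝ × Ω => ((fun c : Iic a => η c ω' - η a ω', q.1), q.2))
        (by fun_prop)
    simp only [hΦ]
    rw [lintegral_lintegral_swap hj.aemeasurable]
    refine lintegral_congr fun ω => ?_
    exact (lintegral_const_mul _ (hQfm.comp measurable_prodMk_right)).symm
  simp_rw [e1, e2]
  rw [← lintegral_map (f := Φ) (g := fun ω' => (fun c : Iic a => η c ω' - η a ω', η b ω' - η a ω'))
    hΦm (hWm.prodMk hDm), hlaw, lintegral_prod _ hΦm.aemeasurable,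
    lintegral_map hΦm.lintegral_prod_right' hWm]

/-- For a frozen clock, shift `V` so that the later time becomes `h`. All the randomness of the
clock then sits in the earlier time, through a single increment independent of `V`. -/
theorem map_subordinate_prodMk (hV : IsStationaryMarkov μ V Q)
    (hη : IsTwoSidedSubordinator ρ η m) {a b : ℝ} (hab : a ≤ b) (h : ℝ) :
    (μ.prod ρ).map (fun p => (subordinate V η a p, subordinate V η b p))
      = (μ.prod (m (b - a))).map (fun p => (V (h - p.2) p.1, V h p.1)) := by
  have := hη.isProbabilityMeasure (sub_nonneg.2 hab)
  have hU := measurable_subordinate hV hη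
  have hr : Measurable fun p : Ω × ℝ => (V (h - p.2) p.1, V h p.1) := by
    refine Measurable.prodMk ?_ ((hV.measurable_apply h).comp measurable_fst)
    exact hV.measurable.comp ((measurable_snd.const_sub h).prodMk measurable_fst)
  have hDm : Measurable fun ω => η b ω - η a ω := (hη.measurable _).sub (hη.measurable _)
  refine Measure.ext_of_lintegral _ fun H hH => ?_
  rw [lintegral_map hH ((hU a).prodMk (hU b)), lintegral_map hH hr,
    lintegral_prod_symm (fun p => H (subordinate V η a p, subordinate V η b p))
      (hH.comp ((hU a).prodMk (hU b))).aemeasurable,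
    lintegral_prod_symm (fun p : Ω × ℝ => H (V (h - p.2) p.1, V h p.1))
      (hH.comp hr).aemeasurable, ← hη.map_sub a b hab,
    lintegral_map (f := fun d => ∫⁻ ω, H (V (h - d) ω, V h ω) ∂μ)
      (hH.comp hr).lintegral_prod_left' hDm]
  refine lintegral_congr fun ω' => ?_
  have hG : Measurable fun z : ℝ → ℝ => H (z (h - (η b ω' - η a ω')), z h) := by fun_prop
  have := hV.lintegral_shift (η b ω' - h) hG
  rw [← this]
  refine lintegral_congr fun ω => ?_
  simp only [subordinate]
  congr 3 <;> ring

theorem map_subordinate (hV : IsStationaryMarkov μ V Q)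
    (hη : IsTwoSidedSubordinator ρ η m) (a h : ℝ) :
    (μ.prod ρ).map (subordinate V η a) = μ.map (V h) := by
  have := hη.isProbabilityMeasure (d := a - a) (by simp)
  have h1 := congrArg (Measure.map Prod.snd) (map_subordinate_prodMk hV hη (le_refl a) h)
  have hU := measurable_subordinate hV hη
  have hr : Measurable fun p : Ω × ℝ => (V (h - p.2) p.1, V h p.1) := by
    refine Measurable.prodMk ?_ ((hV.measurable_apply h).comp measurable_fst)
    exact hV.measurable.comp ((measurable_snd.const_sub h).prodMk measurable_fst)
  rw [Measure.map_map measurable_snd ((hU a).prodMk (hU a)), Measure.map_map measurable_snd hr]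
    at h1
  have h2 : (μ.prod (m (a - a))).map (fun p => V h p.1) = μ.map (V h) := by
    rw [← Function.comp_def (V h) Prod.fst, ← Measure.map_map (hV.measurable_apply h) measurable_fst,
      Measure.map_fst_prod, measure_univ, one_smul]
  exact h1.trans h2

/-- Induction on the largest time. The Markov property replaces the factor at the last time `b` by a
weight at the preceding time `a`; this weight depends on `b - a` only, so it is the same for the
shifted product and can be absorbed into the factor at `a`. -/
theorem lintegral_prod_subordinate_shift (hV : IsStationaryMarkov μ V Q)
    (hη : IsTwoSidedSubordinator ρ η m) (h : ℝ) (J : Finset ℝ) :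
    ∀ f : ℝ → ℝ → ℝ≥0∞, (∀ i, Measurable (f i)) →
      ∫⁻ p, ∏ i ∈ J, f i (subordinate V η (i + h) p) ∂(μ.prod ρ)
        = ∫⁻ p, ∏ i ∈ J, f i (subordinate V η i p) ∂(μ.prod ρ) := by
  classical
  have hU := measurable_subordinate hV hη
  induction J using Finset.induction_on_max with
  | empty => simp
  | insert b J hJ ih =>
    intro f hf
    have hb : b ∉ J := fun hmem => lt_irrefl _ (hJ b hmem)
    simp only [Finset.prod_insert hb]
    rcases J.eq_empty_or_nonempty with rfl | hne
    · simp only [Finset.prod_empty, mul_one]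
      rw [← lintegral_map (hf b) (hU _), ← lintegral_map (hf b) (hU _),
        map_subordinate hV hη (b + h) 0, map_subordinate hV hη b 0]
    · set a := J.max' hne
      have haJ : a ∈ J := J.max'_mem hne
      have hab : a ≤ b := (hJ a haJ).le
      have hle : ∀ i ∈ J, i ≤ a := fun i hi => J.le_max' i hi
      have := hη.isProbabilityMeasure (sub_nonneg.2 hab)
      set g : ℝ → ℝ≥0∞ := fun x => ∫⁻ d, ∫⁻ y, f b y ∂Q (d, x) ∂m (b - a)
      have hgm : Measurable g := (hf b).lintegral_kernel.lintegral_prod_left'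
      have step : ∀ k, ∫⁻ p, f b (subordinate V η (b + k) p)
            * ∏ i ∈ J, f i (subordinate V η (i + k) p) ∂(μ.prod ρ)
          = ∫⁻ p, ∏ i ∈ J, Function.update f a (fun x => f a x * g x) i
              (subordinate V η (i + k) p) ∂(μ.prod ρ) := by
        intro k
        have hle' : ∀ i : J, (i : ℝ) + k ≤ a + k := fun i => by
          have := hle i i.2; linarith
        have key := lintegral_mul_subordinate hV hη (add_le_add_left hab k)
          (F := fun z => ∏ i : J, f i (z ⟨i + k, hle' i⟩))
          (Finset.measurable_prod _ fun i _ => (hf i).comp (measurable_pi_apply _)) (hf b)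
        rw [show b + k - (a + k) = b - a by ring] at key
        have conv : ∀ p, ∏ i : J, f i (subordinate V η (i + k) p)
            = ∏ i ∈ J, f i (subordinate V η (i + k) p) := fun p =>
          Finset.prod_coe_sort J fun i => f i (subordinate V η (i + k) p)
        simp only [conv] at key
        simp_rw [mul_comm (f b _)]
        rw [key]
        refine lintegral_congr fun p => ?_
        rw [← Finset.mul_prod_erase _ _ haJ, ← Finset.mul_prod_erase _ _ haJ,
          Function.update_self]
        have : ∏ i ∈ J.erase a, Function.update f a (fun x => f a x * g x) i
              (subordinate V η (i + k) p)
            = ∏ i ∈ J.erase a, f i (subordinate V η (i + k) p) :=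
          Finset.prod_congr rfl fun i hi => by
            rw [Function.update_of_ne (Finset.ne_of_mem_erase hi)]
        rw [this]
        ring
      have s0 := step 0
      simp only [add_zero] at s0
      rw [step h, s0]
      refine ih _ fun i => ?_
      rcases eq_or_ne i a with rfl | hi
      · rw [Function.update_self]; exact (hf _).mul hgm
      · rw [Function.update_of_ne hi]; exact hf i

/-- Two measurable families whose products of coordinate functions have the same integrals have the
same law. -/
theorem map_eq_of_lintegral_prod {Ω ι : Type*} [MeasurableSpace Ω] {μ : Measure Ω}
    [IsProbabilityMeasure μ] [Fintype ι] {X Y : Ω → ι → ℝ} (hX : Measurable X) (hY : Measurable Y)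
    (h : ∀ f : ι → ℝ → ℝ≥0∞, (∀ i, Measurable (f i)) →
      ∫⁻ ω, ∏ i, f i (X ω i) ∂μ = ∫⁻ ω, ∏ i, f i (Y ω i) ∂μ) :
    μ.map X = μ.map Y := by
  have := Measure.isProbabilityMeasure_map (μ := μ) hX.aemeasurable
  have := Measure.isProbabilityMeasure_map (μ := μ) hY.aemeasurable
  refine MeasureTheory.ext_of_generate_finite _ generateFrom_pi.symm isPiSystem_pi ?_ (by simp)
  rintro _ ⟨s, hs, rfl⟩
  have hs' : ∀ i, MeasurableSet (s i) := fun i => hs i (mem_univ i)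
  have hset : MeasurableSet (univ.pi s) := .univ_pi hs'
  have key : ∀ W : Ω → ι → ℝ, Measurable W → μ.map W (univ.pi s)
      = ∫⁻ ω, ∏ i, (s i).indicator (fun _ => (1 : ℝ≥0∞)) (W ω i) ∂μ := by
    intro W hW
    rw [Measure.map_apply hW hset, ← lintegral_indicator_one (hW hset)]
    refine lintegral_congr fun ω => ?_
    by_cases hω : W ω ∈ univ.pi s
    · rw [indicator_of_mem (show ω ∈ W ⁻¹' univ.pi s from hω), Finset.prod_eq_one]
      · rfl
      · exact fun i _ => indicator_of_mem (hω i (mem_univ i)) _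
    · rw [indicator_of_notMem (show ω ∉ W ⁻¹' univ.pi s from hω)]
      obtain ⟨i, hi⟩ : ∃ i, W ω i ∉ s i := by simpa using hω
      exact (Finset.prod_eq_zero (Finset.mem_univ i) (indicator_of_notMem hi _)).symm
  rw [key X hX, key Y hY]
  exact h _ fun i => measurable_const.indicator (hs' i)

theorem map_subordinate_shift (hV : IsStationaryMarkov μ V Q)
    (hη : IsTwoSidedSubordinator ρ η m) (h : ℝ) :
    (μ.prod ρ).map (fun p x => subordinate V η (x + h) p)
      = (μ.prod ρ).map (fun p x => subordinate V η x p) := by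
  classical
  have hU := measurable_subordinate hV hη
  refine (map_eq_iff_forall_finset_map_restrict_eq
    (X := fun x p => subordinate V η (x + h) p) (Y := fun x p => subordinate V η x p)
    (measurable_pi_lambda _ fun x => hU _).aemeasurable
    (measurable_pi_lambda _ fun x => hU _).aemeasurable).2 fun J => ?_
  refine map_eq_of_lintegral_prod (measurable_pi_lambda _ fun x => hU _)
    (measurable_pi_lambda _ fun x => hU _) fun f hf => ?_
  have key := lintegral_prod_subordinate_shift hV hη h J
    (fun i => if hi : i ∈ J then f ⟨i, hi⟩ else 1)
    (fun i => by by_cases hi : i ∈ J <;> simp [hi, hf, measurable_one])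
  have conv : ∀ w : ℝ → ℝ, ∏ i : J, f i (w i)
      = ∏ i ∈ J, (if hi : i ∈ J then f ⟨i, hi⟩ else 1) (w i) := by
    intro w
    rw [← Finset.prod_coe_sort J]
    exact Finset.prod_congr rfl fun i _ => by simp
  have c1 := fun p => conv fun x => subordinate V η (x + h) p
  have c2 := fun p => conv fun x => subordinate V η x p
  simp only [Finset.restrict, c1, c2]
  exact key

end

/-! ### Kernels and conditioning -/

/-- A jointly measurable family of processes has a jointly measurable disintegration of the laws of
the pairs `(V 0, V d)`. -/
theorem exists_kernel_pair {Ω : Type*} [MeasurableSpace Ω] {μ : Measure Ω} [IsProbabilityMeasure μ]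
    {V : ℝ → Ω → ℝ} (hV : Measurable fun p : ℝ × Ω => V p.1 p.2) :
    ∃ Q : Kernel (ℝ × ℝ) ℝ, IsMarkovKernel Q ∧ ∀ d,
      μ.map (fun ω => (V 0 ω, V d ω)) = (μ.map (V 0)) ⊗ₘ Q.comap (fun x => (d, x)) (by fun_prop) := by
  have hVa : ∀ a, Measurable (V a) := fun a => hV.comp measurable_prodMk_left
  have hp : ∀ d, Measurable fun ω => (V 0 ω, V d ω) := fun d => (hVa 0).prodMk (hVa d)
  -- Disintegrating one kernel with parameter `d`, instead of each law separately, makes the result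
  -- jointly measurable in `(d, x)`, as needed to integrate over a random `d`.
  let κ : Kernel ℝ (ℝ × ℝ) :=
    { toFun := fun d => μ.map fun ω => (V 0 ω, V d ω)
      measurable' := by
        refine Measure.measurable_of_measurable_coe _ fun s hs => ?_
        have hs' : MeasurableSet {p : ℝ × Ω | (V 0 p.2, V p.1 p.2) ∈ s} :=
          (((hVa 0).comp measurable_snd).prodMk hV) hs
        simp_rw [Measure.map_apply (hp _) hs]
        exact measurable_measure_prodMk_left (ν := μ) hs' }
  have : IsMarkovKernel κ := ⟨fun d => Measure.isProbabilityMeasure_map (hp d).aemeasurable⟩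
  refine ⟨κ.condKernel, inferInstance, fun d => ?_⟩
  have h1 : (κ.fst ⊗ₖ κ.condKernel) d = μ.map fun ω => (V 0 ω, V d ω) := by
    rw [κ.disintegrate κ.condKernel]; rfl
  rw [← h1, Kernel.compProd_apply_eq_compProd_sectR]
  congr 1
  · rw [Kernel.fst_apply]
    change (μ.map fun ω => (V 0 ω, V d ω)).map Prod.fst = _
    rw [Measure.map_map measurable_fst (hp d)]
    rfl

/-- A stochastic process seen through a kernel: if the past up to `s` and the value at `t` are
linked by a kernel that only looks at the value at `s`, then conditioning on the past amounts to
conditioning on the present. -/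
theorem condExp_naturalFiltration_ae_eq_of_kernel {Ω : Type*} [MeasurableSpace Ω] {μ : Measure Ω}
    [IsProbabilityMeasure μ] {Y : ℝ≥0 → Ω → ℝ} (hY : ∀ t, Measurable (Y t)) (s t : ℝ≥0)
    (K : Kernel ℝ ℝ) [IsMarkovKernel K]
    (h : μ.map (fun ω => (fun c : Iic s => Y c ω, Y t ω))
      = μ.map (fun ω (c : Iic s) => Y c ω) ⊗ₘ
        K.comap (fun z : Iic s → ℝ => z ⟨s, mem_Iic.2 le_rfl⟩) (measurable_pi_apply _))
    {g : ℝ → ℝ} (hg : Measurable g) (hi : Integrable (fun ω => g (Y t ω)) μ) :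
    μ[fun ω => g (Y t ω) | naturalFiltration Y hY s] =ᵐ[μ]
      μ[fun ω => g (Y t ω) | MeasurableSpace.comap (Y s) inferInstance] := by
  have hpath : Measurable fun ω (c : Iic s) => Y c ω := measurable_pi_lambda _ fun c => hY _
  have hev : Measurable fun z : Iic s → ℝ => z ⟨s, mem_Iic.2 le_rfl⟩ := measurable_pi_apply _
  -- Projecting the path onto its value at `s` shows that the same `K` also disintegrates the pair,
  -- so both conditional expectations integrate `g` against `K (Y s)`.
  have h2 : μ.map (fun ω => (Y s ω, Y t ω)) = μ.map (Y s) ⊗ₘ K := by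
    have := congrArg (Measure.map
      (Prod.map (fun z : Iic s → ℝ => z ⟨s, mem_Iic.2 le_rfl⟩) (id : ℝ → ℝ))) h
    rw [Measure.map_map (hev.prodMap measurable_id) (hpath.prodMk (hY t))] at this
    refine this.trans ?_
    have e : μ.map (Y s) = (μ.map fun ω (c : Iic s) => Y c ω).map
        (fun z : Iic s → ℝ => z ⟨s, mem_Iic.2 le_rfl⟩) := by
      rw [Measure.map_map hev hpath]; rfl
    rw [e]
    refine Measure.ext_of_lintegral _ fun H hH => ?_
    rw [lintegral_map hH (hev.prodMap measurable_id), Measure.lintegral_compProd hH,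
      Measure.lintegral_compProd
        (f := fun p => H (Prod.map (fun z : Iic s → ℝ => z ⟨s, mem_Iic.2 le_rfl⟩) id p))
        (hH.comp (hev.prodMap measurable_id)),
      lintegral_map hH.lintegral_kernel_prod_right' hev]
    rfl
  have d1 := condDistrib_ae_eq_of_measure_eq_compProd _ (hY t).aemeasurable h
  have d2 := condDistrib_ae_eq_of_measure_eq_compProd _ (hY t).aemeasurable h2
  have c1 := condExp_ae_eq_integral_condDistrib hpath (hY t).aemeasurable hg.stronglyMeasurable hi
  have c2 := condExp_ae_eq_integral_condDistrib (hY s) (hY t).aemeasurable hg.stronglyMeasurable hi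
  have hF : (naturalFiltration Y hY s : MeasurableSpace Ω)
      = MeasurableSpace.comap (fun ω (c : Iic s) => Y c ω) inferInstance :=
    Filtration.natural_eq_comap _ _ s
  rw [hF]
  filter_upwards [c1, c2, ae_of_ae_map hpath.aemeasurable d1,
    ae_of_ae_map (hY s).aemeasurable d2] with ω e1 e2 e3 e4
  rw [e1, e2, e3, e4]
  rfl

/-! ### The Lamperti transform -/

/-- The Lamperti transform of a process. -/
noncomputable def lamperti {Ω : Type*} (κ : ℝ) (Z : ℝ≥0 → Ω → ℝ) (a : ℝ) (ω : Ω) : ℝ :=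
  Real.exp (-(κ * a)) * Z (Real.exp a).toNNReal ω

section

variable {Ω : Type*} [MeasurableSpace Ω] {μ : Measure Ω} [IsProbabilityMeasure μ] {κ : ℝ}
  {Z : ℝ≥0 → Ω → ℝ}

theorem lamperti_zero : lamperti κ Z 0 = Z 1 := by
  funext ω
  simp [lamperti]

theorem measurable_lamperti (hZ : Measurable fun p : ℝ≥0 × Ω => Z p.1 p.2) :
    Measurable fun p : ℝ × Ω => lamperti κ Z p.1 p.2 := by
  have h : Measurable fun p : ℝ × Ω => ((Real.exp p.1).toNNReal, p.2) := by fun_prop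
  have h2 : Measurable fun p : ℝ × Ω => Real.exp (-(κ * p.1)) := by fun_prop
  exact h2.mul (hZ.comp h)

/-- Self-similarity as an identity between the laws of the whole processes. -/
theorem IsSelfSimilar.map_eq (h : IsSelfSimilar κ μ Z) (hZ : ∀ t, Measurable (Z t)) {c : ℝ≥0}
    (hc : 0 < c) :
    μ.map (fun ω t => Z (c * t) ω) = μ.map (fun ω t => (c : ℝ) ^ κ * Z t ω) :=
  (map_eq_iff_forall_finset_map_restrict_eq (X := fun t ω => Z (c * t) ω)
    (Y := fun t ω => (c : ℝ) ^ κ * Z t ω)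
    (measurable_pi_lambda _ fun _ => hZ _).aemeasurable
    (measurable_pi_lambda _ fun _ => (hZ _).const_mul _).aemeasurable).2 fun I => h c hc I

/-- An additive shift by `r` is a dilation of time by `e^r`, whose factor `e^{κr}` is cancelled by
the exponential weight. -/
theorem map_lamperti_shift (h : IsSelfSimilar κ μ Z) (hZ : ∀ t, Measurable (Z t)) (r : ℝ) :
    μ.map (fun ω x => lamperti κ Z (x + r) ω) = μ.map (fun ω x => lamperti κ Z x ω) := by
  set c : ℝ≥0 := (Real.exp r).toNNReal
  have hc0 : 0 < c := Real.toNNReal_pos.2 (Real.exp_pos r)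
  have hcr : (c : ℝ) = Real.exp r := Real.coe_toNNReal _ (Real.exp_pos r).le
  set S : (ℝ≥0 → ℝ) → ℝ → ℝ := fun z x => Real.exp (-(κ * (x + r))) * z (Real.exp x).toNNReal
  have hS : Measurable S := measurable_pi_lambda _ fun x =>
    (measurable_pi_apply _).const_mul _
  have key := congrArg (Measure.map S) (h.map_eq hZ hc0)
  rw [Measure.map_map hS (measurable_pi_lambda _ fun _ => hZ _),
    Measure.map_map hS (measurable_pi_lambda _ fun _ => (hZ _).const_mul _)] at key
  convert key using 2
  · funext ω x
    simp only [S, lamperti, Function.comp]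
    rw [Real.exp_add, mul_comm (Real.exp x), Real.toNNReal_mul (Real.exp_pos r).le]
  · funext ω x
    simp only [S, lamperti, Function.comp]
    rw [hcr, ← Real.exp_mul, ← mul_assoc, ← Real.exp_add]
    ring_nf

theorem measurableSet_naturalFiltration_lamperti (hZ : ∀ t, Measurable (Z t))
    {A : Set (Iic (0 : ℝ) → ℝ)} (hA : MeasurableSet A) :
    MeasurableSet[naturalFiltration Z hZ 1] ((fun ω (c : Iic (0 : ℝ)) => lamperti κ Z c ω) ⁻¹' A) := by
  have hF : (naturalFiltration Z hZ 1 : MeasurableSpace Ω)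
      = MeasurableSpace.comap (fun ω (c : Iic (1 : ℝ≥0)) => Z c ω) inferInstance :=
    Filtration.natural_eq_comap _ _ _
  rw [hF]
  have hexp : ∀ c : Iic (0 : ℝ), (Real.exp c).toNNReal ∈ Iic (1 : ℝ≥0) := fun c => by
    rw [mem_Iic, Real.toNNReal_le_one, Real.exp_le_one_iff]
    exact c.2
  have hm : Measurable fun (z : Iic (1 : ℝ≥0) → ℝ) (c : Iic (0 : ℝ)) =>
      Real.exp (-(κ * c)) * z ⟨(Real.exp c).toNNReal, hexp c⟩ :=
    measurable_pi_lambda _ fun c => (measurable_pi_apply _).const_mul _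
  exact ⟨_, hm hA, rfl⟩

/-- The past of `V` up to time `0` lies in the past of `Z` up to time `1 = e^0`, so the Markov
property of `Z` between `1` and `e^d` applies. The kernel obtained from the pair then serves for the
whole past. -/
theorem markov_lamperti (hZ : ∀ t, Measurable (Z t)) (hm : IsMarkovProcess μ Z hZ)
    (Q : Kernel (ℝ × ℝ) ℝ) [IsMarkovKernel Q] {d : ℝ} (hd : 0 ≤ d)
    (hQ : μ.map (fun ω => (lamperti κ Z 0 ω, lamperti κ Z d ω))
      = (μ.map (lamperti κ Z 0)) ⊗ₘ Q.comap (fun x => (d, x)) (by fun_prop)) :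
    μ.map (fun ω => (fun c : Iic (0 : ℝ) => lamperti κ Z c ω, lamperti κ Z d ω))
      = μ.map (fun ω (c : Iic (0 : ℝ)) => lamperti κ Z c ω) ⊗ₘ
        Q.comap (fun z : Iic (0 : ℝ) → ℝ => (d, z ⟨0, mem_Iic.2 le_rfl⟩)) (by fun_prop) := by
  set V := lamperti κ Z
  have hV : ∀ a, Measurable (V a) := fun a => (hZ _).const_mul _
  have hpath : Measurable fun ω (c : Iic (0 : ℝ)) => V c ω := measurable_pi_lambda _ fun c => hV _
  have := Measure.isProbabilityMeasure_map (μ := μ) (hpath.prodMk (hV d)).aemeasurable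
  refine Measure.ext_prod fun {A B} hA hB => ?_
  rw [Measure.map_apply (hpath.prodMk (hV d)) (hA.prod hB), Measure.compProd_apply_prod hA hB,
    setLIntegral_map hA (Kernel.measurable_coe _ hB) hpath]
  set A' := (fun ω (c : Iic (0 : ℝ)) => V c ω) ⁻¹' A
  have hA'm : MeasurableSet A' := hpath hA
  have hT : (1 : ℝ≥0) ≤ (Real.exp d).toNNReal := by
    rw [Real.one_le_toNNReal]; exact Real.one_le_exp hd
  have h0 : V 0 = Z 1 := lamperti_zero
  have d1 := condDistrib_ae_eq_of_measure_eq_compProd _ (hV d).aemeasurable hQ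
  have c1 := condDistrib_ae_eq_condExp (μ := μ) (hV 0) (hV d) hB
  have c2 := hm 1 _ hT (fun z => B.indicator (fun _ => (1 : ℝ)) (Real.exp (-(κ * d)) * z))
    ((measurable_const.indicator hB).comp (measurable_id.const_mul _))
    ⟨1, fun x => by
      by_cases hx : Real.exp (-(κ * d)) * x ∈ B <;> simp [hx]⟩
  have hind : (fun ω => B.indicator (fun _ => (1 : ℝ))
      (Real.exp (-(κ * d)) * Z (Real.exp d).toNNReal ω)) = (V d ⁻¹' B).indicator fun _ => (1 : ℝ) := by
    funext ω
    rfl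
  simp only [hind] at c2
  rw [h0] at c1
  have hle := (naturalFiltration Z hZ).le 1
  have hint : Integrable ((V d ⁻¹' B).indicator fun _ => (1 : ℝ)) μ :=
    (integrable_const _).indicator (hV d hB)
  -- On the event `A'` of the past, the indicator of `V d ∈ B` may be replaced by its conditional
  -- expectation, which is a function of `V 0` by `c2`.
  have key : ∫ ω in A', (Q (d, V 0 ω)).real B ∂μ
      = ∫ ω in A', (V d ⁻¹' B).indicator (fun _ => (1 : ℝ)) ω ∂μ := by
    rw [← setIntegral_condExp hle hint (measurableSet_naturalFiltration_lamperti hZ hA)]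
    refine setIntegral_congr_ae hA'm ?_
    filter_upwards [c1, c2, ae_of_ae_map (hV 0).aemeasurable d1] with ω e1 e2 e3 _
    rw [e2, ← e1, ← h0, e3]
    rfl
  rw [integral_indicator_const _ (hV d hB), smul_eq_mul, mul_one] at key
  simp only [Measure.real] at key
  rw [integral_toReal, ENNReal.toReal_eq_toReal_iff'] at key
  · rw [Measure.restrict_apply (hV d hB)] at key
    rw [inter_comm] at key
    exact key.symm
  · exact ((lintegral_mono fun ω => prob_le_one).trans_lt (by simp)).ne
  · exact measure_ne_top _ _
  · exact ((Kernel.measurable_coe Q hB).comp (measurable_const.prodMk (hV 0))).aemeasurable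
  · exact .of_forall fun ω => measure_lt_top _ _

theorem exists_isStationaryMarkov_lamperti (hZ : ∀ t, Measurable (Z t))
    (hZj : Measurable fun p : ℝ≥0 × Ω => Z p.1 p.2) (hm : IsMarkovProcess μ Z hZ)
    (h : IsSelfSimilar κ μ Z) :
    ∃ Q : Kernel (ℝ × ℝ) ℝ, IsMarkovKernel Q ∧ IsStationaryMarkov μ (lamperti κ Z) Q := by
  obtain ⟨Q, hQm, hQ⟩ := exists_kernel_pair (μ := μ) (measurable_lamperti (κ := κ) hZj)
  refine ⟨Q, hQm, measurable_lamperti hZj, map_lamperti_shift h hZ, fun d hd F hF f hf => ?_⟩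
  have hV : ∀ a, Measurable (lamperti κ Z a) := fun a => (hZ _).const_mul _
  have hpath : Measurable fun ω (c : Iic (0 : ℝ)) => lamperti κ Z c ω :=
    measurable_pi_lambda _ fun c => hV _
  have key := markov_lamperti hZ hm Q hd (hQ d)
  have hG : Measurable fun p : (Iic (0 : ℝ) → ℝ) × ℝ => F p.1 * f p.2 := by fun_prop
  have k2 := congrArg (fun ν => ∫⁻ p, F p.1 * f p.2 ∂ν) key
  rw [lintegral_map hG (hpath.prodMk (hV d)), Measure.lintegral_compProd hG,
    lintegral_map hG.lintegral_kernel_prod_right' hpath] at k2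
  refine k2.trans (lintegral_congr fun ω => ?_)
  exact lintegral_const_mul (μ := Q (d, lamperti κ Z 0 ω))
    (F fun c : Iic (0 : ℝ) => lamperti κ Z c ω) hf

end

theorem IsSubordinator.isTwoSidedSubordinator {Ω₁ : Type*} [MeasurableSpace Ω₁] {ν : Measure Ω₁}
    [IsProbabilityMeasure ν] {ζ : ℝ≥0 → Ω₁ → ℝ} (h : IsSubordinator ν ζ) :
    IsTwoSidedSubordinator (ν.prod ν) (twoSided ζ) fun d => ν.map (ζ d.toNNReal) where
  measurable := h.measurable_twoSided
  monotone := h.monotone_twoSided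
  map_sub _ _ hab := h.map_twoSided_sub hab
  indep _ _ hab := h.indepFun_twoSided hab

/-! ### The inverse Lamperti transform -/

/-- The inverse Lamperti transform of a process on the time set `ℝ`, started at `0`. -/
noncomputable def lampertiInv {Ω : Type*} (κ : ℝ) (U : ℝ → Ω → ℝ) (t : ℝ≥0) (ω : Ω) : ℝ :=
  if t = 0 then 0 else (t : ℝ) ^ κ * U (Real.log t) ω

theorem lampertiInv_of_pos {Ω : Type*} {κ : ℝ} {U : ℝ → Ω → ℝ} {t : ℝ≥0} (ht : 0 < t) :
    lampertiInv κ U t = fun ω => (t : ℝ) ^ κ * U (Real.log t) ω := by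
  funext ω
  simp [lampertiInv, ht.ne']

section

variable {Ω : Type*} [MeasurableSpace Ω] {κ : ℝ}

theorem measurable_lampertiInv {U : ℝ → Ω → ℝ} (hU : ∀ a, Measurable (U a)) (t : ℝ≥0) :
    Measurable (lampertiInv κ U t) := by
  rcases eq_or_ne t 0 with rfl | ht
  · have : lampertiInv κ U 0 = fun _ => 0 := by funext ω; simp [lampertiInv]
    rw [this]; exact measurable_const
  · rw [lampertiInv_of_pos (pos_iff_ne_zero.2 ht)]
    exact (hU _).const_mul _

/-- With `r = e^{-d}` the right side is `c^κ Z_{rt}`, where `c = s/(tr)` satisfies `c · rt = s`: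
self-similarity will identify its law with that of `Z_s`. -/
theorem rpow_mul_lamperti {Z : ℝ≥0 → Ω → ℝ} {s t : ℝ≥0} (hs : 0 < s) (ht : 0 < t) (d : ℝ) (ω : Ω) :
    (s : ℝ) ^ κ * lamperti κ Z (Real.log t - d) ω
      = ((s : ℝ) / (t * Real.exp (-d))) ^ κ * Z ((Real.exp (-d)).toNNReal * t) ω := by
  have hs' : (0 : ℝ) < s := hs
  have ht' : (0 : ℝ) < t := ht
  have he : Real.exp (Real.log t - d) = Real.exp (-d) * t := by
    rw [sub_eq_neg_add, Real.exp_add, Real.exp_log ht']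
  rw [lamperti, he, Real.toNNReal_mul (Real.exp_pos _).le, Real.toNNReal_coe, ← mul_assoc,
    Real.div_rpow hs'.le (by positivity), mul_comm (t : ℝ), ← he, ← Real.exp_mul, Real.exp_neg,
    div_eq_mul_inv, mul_comm κ]

theorem rpow_mul_lamperti_log {Z : ℝ≥0 → Ω → ℝ} {t : ℝ≥0} (ht : 0 < t) (ω : Ω) :
    (t : ℝ) ^ κ * lamperti κ Z (Real.log t) ω = Z t ω := by
  have ht' : (t : ℝ) ≠ 0 := (NNReal.coe_pos.2 ht).ne'
  have := rpow_mul_lamperti (κ := κ) (Z := Z) ht ht 0 ω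
  simpa [ht'] using this

/-- `Z_0` has the law of `c^κ Z_0` for every `c > 0`; letting `c` tend to `0` gives `E[exp (-|Z_0|)]
= 1`. -/
theorem IsSelfSimilar.zero_ae_eq_zero {μ : Measure Ω} [IsProbabilityMeasure μ] {Z : ℝ≥0 → Ω → ℝ}
    (hκ : 0 < κ) (hZ : ∀ t, Measurable (Z t)) (h : IsSelfSimilar κ μ Z) : Z 0 =ᵐ[μ] 0 := by
  have hlaw : ∀ c : ℝ≥0, 0 < c → μ.map (Z 0) = μ.map fun ω => (c : ℝ) ^ κ * Z 0 ω := by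
    intro c hc
    have key := congrArg (Measure.map fun z : ℝ≥0 → ℝ => z 0) (h.map_eq hZ hc)
    rw [Measure.map_map (measurable_pi_apply _) (measurable_pi_lambda _ fun _ => hZ _),
      Measure.map_map (measurable_pi_apply _)
        (measurable_pi_lambda _ fun _ => (hZ _).const_mul _)] at key
    simpa [Function.comp_def] using key
  have hf : Measurable fun x : ℝ => Real.exp (-|x|) := by fun_prop
  have hint : ∀ n : ℕ, ∫ ω, Real.exp (-|Z 0 ω|) ∂μ
      = ∫ ω, Real.exp (-|(1 / ((n : ℝ) + 1)) ^ κ * Z 0 ω|) ∂μ := by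
    intro n
    have hl := hlaw (1 / ((n : ℝ≥0) + 1)) (by positivity)
    push_cast at hl
    rw [← integral_map (hZ 0).aemeasurable hf.aestronglyMeasurable, hl,
      integral_map ((hZ 0).const_mul _).aemeasurable hf.aestronglyMeasurable]
  have hlim : Tendsto (fun n : ℕ => ∫ ω, Real.exp (-|(1 / ((n : ℝ) + 1)) ^ κ * Z 0 ω|) ∂μ) atTop
      (𝓝 (∫ _, Real.exp (-|0|) ∂μ)) := by
    refine tendsto_integral_of_dominated_convergence (fun _ => 1) (fun n => ?_)
      (integrable_const _) (fun n => .of_forall fun ω => ?_) (.of_forall fun ω => ?_)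
    · exact (hf.comp ((hZ 0).const_mul _)).aestronglyMeasurable
    · rw [Real.norm_eq_abs, Real.abs_exp, Real.exp_le_one_iff, neg_nonpos]
      exact abs_nonneg _
    · have h1 : Tendsto (fun n : ℕ => (1 / ((n : ℝ) + 1)) ^ κ * Z 0 ω) atTop (𝓝 0) := by
        have h2 := (tendsto_one_div_add_atTop_nhds_zero_nat (𝕜 := ℝ)).rpow_const
          (p := κ) (Or.inr hκ.le)
        rw [Real.zero_rpow hκ.ne'] at h2
        simpa using h2.mul_const (Z 0 ω)
      exact ((by fun_prop : Continuous fun x : ℝ => Real.exp (-|x|)).tendsto 0).comp h1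
  simp_rw [← hint] at hlim
  have h1 := tendsto_nhds_unique tendsto_const_nhds hlim
  have h2 := ae_eq_zero_of_integral_exp_neg (hZ 0).abs (fun ω => abs_nonneg _)
    (h1.trans (by simp))
  filter_upwards [h2] with ω hω using abs_eq_zero.1 hω

end

section

variable {Ω Ω₂ : Type*} [MeasurableSpace Ω] [MeasurableSpace Ω₂] {μ : Measure Ω}
  [IsProbabilityMeasure μ] {ρ : Measure Ω₂} [IsProbabilityMeasure ρ] {κ : ℝ} {Z : ℝ≥0 → Ω → ℝ}
  {η : ℝ → Ω₂ → ℝ} {Q : Kernel (ℝ × ℝ) ℝ} [IsMarkovKernel Q] {m : ℝ → Measure ℝ}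

/-- The kernel divides by `s^κ`, draws a clock increment from `m (log t - log s)`, moves by `Q` over
that duration and multiplies by `t^κ`. -/
theorem exists_kernel_lampertiInv {V : ℝ → Ω → ℝ} (hV : IsStationaryMarkov μ V Q)
    (hη : IsTwoSidedSubordinator ρ η m) {s t : ℝ≥0} (hs : 0 < s) (hst : s ≤ t) :
    ∃ K : Kernel ℝ ℝ, IsMarkovKernel K ∧
      (μ.prod ρ).map (fun p => (fun c : Iic s => lampertiInv κ (subordinate V η) c p,
          lampertiInv κ (subordinate V η) t p))
        = (μ.prod ρ).map (fun p (c : Iic s) => lampertiInv κ (subordinate V η) c p) ⊗ₘ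
          K.comap (fun z : Iic s → ℝ => z ⟨s, mem_Iic.2 le_rfl⟩) (measurable_pi_apply _) := by
  have ht : 0 < t := hs.trans_le hst
  have hs' : (0 : ℝ) < s := hs
  have hab : Real.log s ≤ Real.log t := Real.log_le_log hs' hst
  set U := subordinate V η with hUdef
  have hU : ∀ a, Measurable (U a) := measurable_subordinate hV hη
  have hX : ∀ r, Measurable (lampertiInv κ U r) := measurable_lampertiInv hU
  have hm := hη.isProbabilityMeasure (sub_nonneg.2 hab)
  set K : Kernel ℝ ℝ := ((Q ∘ₖ ((Kernel.const ℝ (m (Real.log t - Real.log s))) ×ₖ Kernel.id)).comap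
    (fun x : ℝ => ((s : ℝ) ^ κ)⁻¹ * x) (measurable_id.const_mul _)).map
      (fun y : ℝ => (t : ℝ) ^ κ * y) with hK
  have hmul : Measurable fun y : ℝ => (t : ℝ) ^ κ * y := measurable_id.const_mul _
  have hKm : IsMarkovKernel K := Kernel.IsMarkovKernel.map _ hmul
  refine ⟨K, hKm, ?_⟩
  have hpath : Measurable fun p (c : Iic s) => lampertiInv κ U c p :=
    measurable_pi_lambda _ fun c => hX _
  have := Measure.isProbabilityMeasure_map (μ := μ.prod ρ) (hpath.prodMk (hX t)).aemeasurable
  refine Measure.ext_prod fun {A B} hA hB => ?_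
  rw [Measure.map_apply (hpath.prodMk (hX t)) (hA.prod hB), Measure.compProd_apply_prod hA hB,
    setLIntegral_map hA (Kernel.measurable_coe _ hB) hpath]
  -- Rebuilds the path of the process up to `s` from that of `U` up to `log s`. Time `0` is
  -- separate, since `Real.log 0 = 0` need not lie below `log s`.
  set Θ : (Iic (Real.log s) → ℝ) → Iic s → ℝ := fun z c =>
    if hc : (c : ℝ≥0) = 0 then 0 else (c : ℝ) ^ κ * z ⟨Real.log c,
      Real.log_le_log (NNReal.coe_pos.2 (pos_iff_ne_zero.2 hc)) c.2⟩ with hΘ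
  have hΘm : Measurable Θ := measurable_pi_lambda _ fun c => by
    by_cases hc : (c : ℝ≥0) = 0
    · simp only [hΘ, dif_pos hc]; exact measurable_const
    · simp only [hΘ, dif_neg hc]; exact (measurable_pi_apply _).const_mul _
  have hΘU : ∀ p, Θ (fun c => U c p) = fun c : Iic s => lampertiInv κ U c p := by
    intro p; funext c
    simp only [hΘ, lampertiInv]
    split_ifs <;> rfl
  have hB' : Measurable fun y : ℝ => B.indicator (fun _ => (1 : ℝ≥0∞)) ((t : ℝ) ^ κ * y) :=
    (measurable_const.indicator hB).comp hmul
  have key := lintegral_mul_subordinate hV hη hab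
    (F := fun z => A.indicator (fun _ => (1 : ℝ≥0∞)) (Θ z))
    ((measurable_const.indicator hA).comp hΘm) hB'
  simp only [← hUdef, hΘU] at key
  have hKx : ∀ p, K (lampertiInv κ U s p) B
      = ∫⁻ d, ∫⁻ y, B.indicator (fun _ => (1 : ℝ≥0∞)) ((t : ℝ) ^ κ * y) ∂Q (d, U (Real.log s) p)
        ∂m (Real.log t - Real.log s) := by
    intro p
    have hne : (s : ℝ) ^ κ ≠ 0 := (Real.rpow_pos_of_pos hs' κ).ne'
    have hx : ((s : ℝ) ^ κ)⁻¹ * lampertiInv κ U s p = U (Real.log s) p := by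
      rw [lampertiInv_of_pos hs, inv_mul_cancel_left₀ hne]
    have h1 : Measurable fun y => B.indicator (fun _ => (1 : ℝ≥0∞)) y :=
      measurable_const.indicator hB
    rw [← lintegral_indicator_one hB]
    change ∫⁻ y, B.indicator (fun _ => (1 : ℝ≥0∞)) y ∂K _ = _
    rw [hK, Kernel.lintegral_map _ hmul _ h1, Kernel.lintegral_comap, Kernel.lintegral_comp _ _ _ hB',
      hx, Kernel.prod_apply, Kernel.const_apply, Kernel.id_apply,
      lintegral_prod_symm _ hB'.lintegral_kernel.aemeasurable, lintegral_dirac']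
    · exact hB'.lintegral_kernel.lintegral_prod_left'
  rw [← lintegral_indicator (hpath hA), ← lintegral_indicator_one
    ((hpath.prodMk (hX t)) (hA.prod hB))]
  refine Eq.trans ?_ (key.trans ?_)
  · refine lintegral_congr fun p => ?_
    rw [show (t : ℝ) ^ κ * U (Real.log t) p = lampertiInv κ U t p by rw [lampertiInv_of_pos ht]]
    by_cases h1 : (fun c : Iic s => lampertiInv κ U c p) ∈ A <;>
      by_cases h2 : lampertiInv κ U t p ∈ B <;> simp [indicator, h1, h2]
  · refine lintegral_congr fun p => ?_
    rw [← hKx p]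
    by_cases h1 : (fun c : Iic s => lampertiInv κ U c p) ∈ A <;> simp [indicator, h1]

theorem map_lampertiInv_prodMk (hV : IsStationaryMarkov μ (lamperti κ Z) Q)
    (hη : IsTwoSidedSubordinator ρ η m) {s t : ℝ≥0} (hs : 0 < s) (hst : s ≤ t) (h : ℝ) :
    (μ.prod ρ).map (fun p => (lampertiInv κ (subordinate (lamperti κ Z) η) s p,
        lampertiInv κ (subordinate (lamperti κ Z) η) t p))
      = (μ.prod (m (Real.log t - Real.log s))).map (fun p =>
        ((s : ℝ) ^ κ * lamperti κ Z (h - p.2) p.1, (t : ℝ) ^ κ * lamperti κ Z h p.1)) := by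
  have ht : 0 < t := hs.trans_le hst
  have hab : Real.log s ≤ Real.log t := Real.log_le_log hs hst
  have hU := measurable_subordinate hV hη
  have hr : Measurable fun p : Ω × ℝ => (lamperti κ Z (h - p.2) p.1, lamperti κ Z h p.1) := by
    refine Measurable.prodMk ?_ ((hV.measurable_apply h).comp measurable_fst)
    exact hV.measurable.comp ((measurable_snd.const_sub h).prodMk measurable_fst)
  have hg : Measurable fun x : ℝ × ℝ => ((s : ℝ) ^ κ * x.1, (t : ℝ) ^ κ * x.2) := by fun_prop
  have key := congrArg (Measure.map fun x : ℝ × ℝ => ((s : ℝ) ^ κ * x.1, (t : ℝ) ^ κ * x.2))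
    (map_subordinate_prodMk hV hη hab h)
  rw [Measure.map_map hg ((hU _).prodMk (hU _)), Measure.map_map hg hr] at key
  rw [lampertiInv_of_pos hs, lampertiInv_of_pos ht]
  exact key

theorem map_lampertiInv (hκ : 0 < κ) (hZ : ∀ t, Measurable (Z t)) (hss : IsSelfSimilar κ μ Z)
    (hV : IsStationaryMarkov μ (lamperti κ Z) Q) (hη : IsTwoSidedSubordinator ρ η m) (t : ℝ≥0) :
    (μ.prod ρ).map (lampertiInv κ (subordinate (lamperti κ Z) η) t) = μ.map (Z t) := by
  rcases eq_or_ne t 0 with rfl | ht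
  · have : lampertiInv κ (subordinate (lamperti κ Z) η) 0 = fun _ => 0 := by
      funext ω; simp [lampertiInv]
    rw [this, Measure.map_congr (hss.zero_ae_eq_zero hκ hZ)]
    change _ = μ.map fun _ => (0 : ℝ)
    simp
  · have ht := pos_iff_ne_zero.2 ht
    have hU := measurable_subordinate hV hη
    have hmul : Measurable fun y : ℝ => (t : ℝ) ^ κ * y := measurable_id.const_mul _
    have key := congrArg (Measure.map fun y : ℝ => (t : ℝ) ^ κ * y)
      (map_subordinate hV hη (Real.log t) (Real.log t))
    rw [Measure.map_map hmul (hU _), Measure.map_map hmul (hV.measurable_apply _)] at key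
    rw [lampertiInv_of_pos ht]
    refine key.trans ?_
    congr 1
    funext ω
    exact rpow_mul_lamperti_log ht ω

/-- Dilating time by `c` shifts `U` by `log c`, under which `U` is stationary; the remaining factor
is `c^κ`. -/
theorem map_lampertiInv_scale {V : ℝ → Ω → ℝ} (hV : IsStationaryMarkov μ V Q)
    (hη : IsTwoSidedSubordinator ρ η m) {c : ℝ≥0} (hc : 0 < c) :
    (μ.prod ρ).map (fun p t => lampertiInv κ (subordinate V η) (c * t) p)
      = (μ.prod ρ).map (fun p t => (c : ℝ) ^ κ * lampertiInv κ (subordinate V η) t p) := by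
  have hU := measurable_subordinate hV hη
  set S : (ℝ → ℝ) → ℝ≥0 → ℝ := fun u t =>
    if t = 0 then 0 else ((c * t : ℝ≥0) : ℝ) ^ κ * u (Real.log t) with hS
  have hSm : Measurable S := measurable_pi_lambda _ fun t => by
    by_cases ht : t = 0
    · simp only [hS, if_pos ht]; exact measurable_const
    · simp only [hS, if_neg ht]; exact (measurable_pi_apply _).const_mul _
  have key := congrArg (Measure.map S) (map_subordinate_shift hV hη (Real.log c))
  rw [Measure.map_map hSm (measurable_pi_lambda _ fun _ => hU _),
    Measure.map_map hSm (measurable_pi_lambda _ fun _ => hU _)] at key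
  have hc' : (0 : ℝ) < c := hc
  convert key using 2
  · funext p t
    simp only [Function.comp, hS, lampertiInv, mul_eq_zero, hc.ne', false_or]
    split_ifs with ht
    · rfl
    · have ht' : (t : ℝ) ≠ 0 := NNReal.coe_ne_zero.2 ht
      rw [NNReal.coe_mul, Real.log_mul hc'.ne' ht', add_comm]
  · funext p t
    simp only [Function.comp, hS, lampertiInv]
    split_ifs with ht
    · simp
    · rw [NNReal.coe_mul, Real.mul_rpow hc'.le t.coe_nonneg, mul_assoc]

end

/-! ### The random factors and the randomised transition function -/

theorem coe_rpow_mul_coe_rpow (a b : ℝ≥0) (κ : ℝ) :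
    (a : ℝ) ^ κ * (b : ℝ) ^ κ = ((a * b : ℝ≥0) : ℝ) ^ κ := by
  rw [NNReal.coe_mul, Real.mul_rpow a.coe_nonneg b.coe_nonneg]

/-- The random variable `R_u = exp (-ζ_{log u})`. -/
noncomputable def randomFactor {Ω₁ : Type*} (ζ : ℝ≥0 → Ω₁ → ℝ) (u : ℝ≥0) (ω : Ω₁) : ℝ≥0 :=
  (Real.exp (-ζ (Real.log u).toNNReal ω)).toNNReal

theorem coe_randomFactor {Ω₁ : Type*} (ζ : ℝ≥0 → Ω₁ → ℝ) (u : ℝ≥0) (ω : Ω₁) :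
    (randomFactor ζ u ω : ℝ) = Real.exp (-ζ (Real.log u).toNNReal ω) :=
  Real.coe_toNNReal _ (Real.exp_pos _).le

theorem randomFactor_pos {Ω₁ : Type*} (ζ : ℝ≥0 → Ω₁ → ℝ) (u : ℝ≥0) (ω : Ω₁) :
    0 < randomFactor ζ u ω :=
  Real.toNNReal_pos.2 (Real.exp_pos _)

namespace IsSubordinator

variable {Ω₁ : Type*} [MeasurableSpace Ω₁] {ν : Measure Ω₁} [IsProbabilityMeasure ν]
  {ζ : ℝ≥0 → Ω₁ → ℝ}

theorem nonneg (h : IsSubordinator ν ζ) (a : ℝ≥0) (ω : Ω₁) : 0 ≤ ζ a ω :=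
  (h.zero ω).symm.le.trans (h.monotone ω bot_le)

theorem randomFactor_le_one (h : IsSubordinator ν ζ) (u : ℝ≥0) (ω : Ω₁) :
    randomFactor ζ u ω ≤ 1 := by
  rw [← NNReal.coe_le_coe, coe_randomFactor, NNReal.coe_one, Real.exp_le_one_iff, neg_nonpos]
  exact h.nonneg _ _

theorem randomFactor_one (h : IsSubordinator ν ζ) (ω : Ω₁) : randomFactor ζ 1 ω = 1 := by
  simp [randomFactor, h.zero]

theorem measurable_uncurry_randomFactor (h : IsSubordinator ν ζ) :
    Measurable fun p : ℝ≥0 × Ω₁ => randomFactor ζ p.1 p.2 := by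
  have h1 : Measurable fun p : ℝ≥0 × Ω₁ => ((Real.log p.1).toNNReal, p.2) := by fun_prop
  exact (Real.measurable_exp.comp (h.measurable_uncurry.comp h1).neg).real_toNNReal

theorem measurable_randomFactor (h : IsSubordinator ν ζ) (u : ℝ≥0) :
    Measurable (randomFactor ζ u) :=
  h.measurable_uncurry_randomFactor.comp measurable_prodMk_left

theorem lintegral_randomFactor_mul (h : IsSubordinator ν ζ) {u v : ℝ≥0} (hu : 1 ≤ u) (hv : 1 ≤ v)
    {f : ℝ≥0 → ℝ≥0∞} (hf : Measurable f) :
    ∫⁻ ω, ∫⁻ ω', f (randomFactor ζ u ω * randomFactor ζ v ω') ∂ν ∂ν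
      = ∫⁻ ω, f (randomFactor ζ (u * v) ω) ∂ν := by
  set a := (Real.log u).toNNReal with ha
  set b := (Real.log v).toNNReal with hb
  have hu' : (1 : ℝ) ≤ u := hu
  have hv' : (1 : ℝ) ≤ v := hv
  have hab : (Real.log (u * v : ℝ≥0)).toNNReal = a + b := by
    rw [ha, hb, ← Real.toNNReal_add (Real.log_nonneg hu') (Real.log_nonneg hv'), NNReal.coe_mul,
      Real.log_mul (by positivity) (by positivity)]
  have hg : Measurable fun x : ℝ => f (Real.exp (-x)).toNNReal := by fun_prop
  have h1 : ∀ ω, f (randomFactor ζ (u * v) ω) = f (Real.exp (-ζ (a + b) ω)).toNNReal := by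
    intro ω; rw [randomFactor, hab]
  have h2 : ∀ ω ω', randomFactor ζ u ω * randomFactor ζ v ω'
      = (Real.exp (-(ζ a ω + ζ b ω'))).toNNReal := by
    intro ω ω'
    rw [randomFactor, randomFactor, ← Real.toNNReal_mul (Real.exp_pos _).le, ← Real.exp_add]
    congr 2
    ring
  simp_rw [h1, h2]
  rw [← lintegral_map (f := fun x : ℝ => f (Real.exp (-x)).toNNReal) hg (h.measurable (a + b)),
    ← h.conv_map, Measure.lintegral_conv hg]
  have hg2 : Measurable fun p : ℝ × ℝ => f (Real.exp (-(p.1 + p.2))).toNNReal := by fun_prop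
  rw [lintegral_map hg2.lintegral_prod_right' (h.measurable a)]
  refine lintegral_congr fun ω => ?_
  exact (lintegral_map (hg.comp (measurable_const_add _)) (h.measurable b)).symm

theorem isRandomisingFamily (h : IsSubordinator ν ζ) {ψ : ℝ → ℝ}
    (hψ : ∀ (a : ℝ≥0) (l : ℝ), 0 ≤ l →
      ∫ ω, Real.exp (-(l * ζ a ω)) ∂ν = Real.exp (-(a * ψ l))) :
    IsRandomisingFamily ψ fun u => ν.map (randomFactor ζ u) := by
  intro u hu
  have hm := h.measurable_randomFactor u
  have hu' : (1 : ℝ) ≤ u := hu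
  refine ⟨Measure.isProbabilityMeasure_map hm.aemeasurable, ?_, fun l hl => ?_⟩
  · rw [Measure.map_apply hm measurableSet_Ioc.compl]
    convert measure_empty (μ := ν)
    ext ω
    simp [randomFactor_pos ζ u ω, h.randomFactor_le_one u ω]
  · rw [integral_map hm.aemeasurable
      (by fun_prop : Measurable fun r : ℝ≥0 => (r : ℝ) ^ l).aestronglyMeasurable]
    simp_rw [coe_randomFactor, ← Real.exp_mul]
    have := hψ (Real.log u).toNNReal l hl
    rw [Real.coe_toNNReal _ (Real.log_nonneg hu')] at this
    rw [Real.rpow_def_of_pos (by positivity)]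
    rw [show Real.log u * -ψ l = -(Real.log u * ψ l) by ring, ← this]
    congr 1
    funext ω
    congr 1
    ring

end IsSubordinator

theorem IsRandomisingFamily.martingale_condition_iff {ψ : ℝ → ℝ} {G : ℝ≥0 → Measure ℝ≥0}
    (h : IsRandomisingFamily ψ G) {κ : ℝ} (hκ : 0 < κ) :
    ψ κ = κ ↔ ∀ s t : ℝ≥0, 0 < s → s ≤ t →
      ∫ r : ℝ≥0, (r : ℝ) ^ κ ∂(G (t / s)) = ((s : ℝ) / t) ^ κ := by
  constructor
  · intro hψ s t hs hst
    have h1 : 1 ≤ t / s := (one_le_div hs).2 hst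
    rw [(h _ h1).2.2 κ hκ.le, hψ, Real.rpow_neg (NNReal.coe_nonneg _),
      ← Real.inv_rpow (NNReal.coe_nonneg _)]
    simp
  · intro hall
    -- The single ratio `t/s = e` is enough: it reads `e^{-ψ(κ)} = e^{-κ}`.
    have he : (1 : ℝ≥0) ≤ (Real.exp 1).toNNReal := by
      rw [Real.one_le_toNNReal]; exact Real.one_le_exp zero_le_one
    have h1 := hall 1 _ one_pos he
    rw [div_one, (h _ he).2.2 κ hκ.le, Real.coe_toNNReal _ (Real.exp_pos _).le, NNReal.coe_one,
      one_div, ← Real.exp_neg, ← Real.exp_mul, ← Real.exp_mul, Real.exp_eq_exp] at h1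
    linarith

section

variable {Ω₁ : Type*} [MeasurableSpace Ω₁] {ν : Measure Ω₁} [IsProbabilityMeasure ν]
  {ζ : ℝ≥0 → Ω₁ → ℝ} {κ : ℝ} {P : ℝ≥0 → ℝ≥0 → ℝ → Measure ℝ}

theorem randomisedTransition_zero (G : ℝ≥0 → Measure ℝ≥0) (t : ℝ≥0) (x : ℝ) :
    randomisedTransition κ G P 0 t x = P 0 t x := if_pos rfl

theorem measurable_transition_comp {α : Type*} [MeasurableSpace α]
    (hP : Measurable fun p : ℝ≥0 × ℝ≥0 × ℝ => P p.1 p.2.1 p.2.2) {f g : α → ℝ≥0} {k : α → ℝ}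
    (hf : Measurable f) (hg : Measurable g) (hk : Measurable k) :
    Measurable fun a => P (f a) (g a) (k a) :=
  hP.comp (hf.prodMk (hg.prodMk hk))

theorem lintegral_randomisedTransition (h : IsSubordinator ν ζ)
    (hP : Measurable fun p : ℝ≥0 × ℝ≥0 × ℝ => P p.1 p.2.1 p.2.2) {s : ℝ≥0} (hs : 0 < s) (t : ℝ≥0)
    (x : ℝ) {f : ℝ → ℝ≥0∞} (hf : Measurable f) :
    ∫⁻ y, f y ∂randomisedTransition κ (fun u => ν.map (randomFactor ζ u)) P s t x
      = ∫⁻ ω, ∫⁻ y, f y ∂P (randomFactor ζ (t / s) ω * t) t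
          (((t / s : ℝ≥0) : ℝ) ^ κ * (randomFactor ζ (t / s) ω : ℝ) ^ κ * x) ∂ν := by
  have hm : Measurable fun r : ℝ≥0 =>
      P (r * t) t (((t / s : ℝ≥0) : ℝ) ^ κ * (r : ℝ) ^ κ * x) :=
    measurable_transition_comp hP (by fun_prop) (by fun_prop) (by fun_prop)
  rw [randomisedTransition, if_neg hs.ne', Measure.lintegral_bind hm.aemeasurable hf.aemeasurable,
    lintegral_map (f := fun r : ℝ≥0 => ∫⁻ y, f y ∂P (r * t) t
      (((t / s : ℝ≥0) : ℝ) ^ κ * (r : ℝ) ^ κ * x))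
      ((Measure.measurable_lintegral hf).comp hm) (h.measurable_randomFactor _)]

theorem randomisedTransition_apply (h : IsSubordinator ν ζ)
    (hP : Measurable fun p : ℝ≥0 × ℝ≥0 × ℝ => P p.1 p.2.1 p.2.2) {s : ℝ≥0} (hs : 0 < s) (t : ℝ≥0)
    (x : ℝ) {B : Set ℝ} (hB : MeasurableSet B) :
    randomisedTransition κ (fun u => ν.map (randomFactor ζ u)) P s t x B
      = ∫⁻ ω, P (randomFactor ζ (t / s) ω * t) t
          (((t / s : ℝ≥0) : ℝ) ^ κ * (randomFactor ζ (t / s) ω : ℝ) ^ κ * x) B ∂ν := by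
  rw [← lintegral_indicator_one hB,
    lintegral_randomisedTransition h hP hs t x (measurable_one.indicator hB)]
  simp_rw [lintegral_indicator_one hB]

theorem measurable_randomisedTransition (h : IsSubordinator ν ζ)
    (hP : Measurable fun p : ℝ≥0 × ℝ≥0 × ℝ => P p.1 p.2.1 p.2.2) :
    Measurable fun p : ℝ≥0 × ℝ≥0 × ℝ =>
      randomisedTransition κ (fun u => ν.map (randomFactor ζ u)) P p.1 p.2.1 p.2.2 := by
  refine Measure.measurable_of_measurable_coe _ fun B hB => ?_
  have hR : Measurable fun q : (ℝ≥0 × ℝ≥0 × ℝ) × Ω₁ => randomFactor ζ (q.1.2.1 / q.1.1) q.2 :=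
    h.measurable_uncurry_randomFactor.comp
      (f := fun q : (ℝ≥0 × ℝ≥0 × ℝ) × Ω₁ => (q.1.2.1 / q.1.1, q.2)) (by fun_prop)
  have hj : Measurable fun q : (ℝ≥0 × ℝ≥0 × ℝ) × Ω₁ =>
      P (randomFactor ζ (q.1.2.1 / q.1.1) q.2 * q.1.2.1) q.1.2.1
        (((q.1.2.1 / q.1.1 : ℝ≥0) : ℝ) ^ κ * (randomFactor ζ (q.1.2.1 / q.1.1) q.2 : ℝ) ^ κ
          * q.1.2.2) B :=
    (Measure.measurable_coe hB).comp
      (measurable_transition_comp hP (by fun_prop) (by fun_prop) (by fun_prop))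
  have h0 : Measurable fun p : ℝ≥0 × ℝ≥0 × ℝ => P 0 p.2.1 p.2.2 B :=
    (Measure.measurable_coe hB).comp
      (measurable_transition_comp hP (by fun_prop) (by fun_prop) (by fun_prop))
  have hset : MeasurableSet {p : ℝ≥0 × ℝ≥0 × ℝ | p.1 = 0} :=
    measurable_fst (measurableSet_singleton 0)
  have hite : Measurable fun p : ℝ≥0 × ℝ≥0 × ℝ => if p.1 = 0 then P 0 p.2.1 p.2.2 B else
      ∫⁻ ω, P (randomFactor ζ (p.2.1 / p.1) ω * p.2.1) p.2.1 (((p.2.1 / p.1 : ℝ≥0) : ℝ) ^ κ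
        * (randomFactor ζ (p.2.1 / p.1) ω : ℝ) ^ κ * p.2.2) B ∂ν :=
    Measurable.ite hset h0 hj.lintegral_prod_right'
  convert hite using 1
  funext p
  obtain ⟨s, t, x⟩ := p
  rcases eq_or_ne s 0 with rfl | hs
  · simp [randomisedTransition_zero]
  · simp only [hs, if_false]
    exact randomisedTransition_apply h hP (pos_iff_ne_zero.2 hs) t x hB

theorem isProbabilityMeasure_randomisedTransition (h : IsSubordinator ν ζ)
    (hP : Measurable fun p : ℝ≥0 × ℝ≥0 × ℝ => P p.1 p.2.1 p.2.2)
    (hprob : ∀ s t x, s ≤ t → IsProbabilityMeasure (P s t x)) (s t : ℝ≥0) (x : ℝ) (hst : s ≤ t) :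
    IsProbabilityMeasure (randomisedTransition κ (fun u => ν.map (randomFactor ζ u)) P s t x) := by
  rcases eq_or_ne s 0 with rfl | hs
  · rw [randomisedTransition_zero]; exact hprob _ _ _ hst
  · refine ⟨?_⟩
    rw [randomisedTransition_apply h hP (pos_iff_ne_zero.2 hs) t x .univ]
    have : ∀ ω y, P (randomFactor ζ (t / s) ω * t) t y univ = 1 := fun ω y =>
      (hprob _ _ _ (mul_le_of_le_one_left' (h.randomFactor_le_one _ ω))).measure_univ
    simp [this]

/-- Scaling turns the step from `s` to `t` into one from `cs` to `ct`, which Chapman–Kolmogorov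
joins to the step from `ct` to `u`. -/
theorem IsScalingTransitionSystem.lintegral_scaled (hS : IsScalingTransitionSystem κ P)
    (hP : Measurable fun p : ℝ≥0 × ℝ≥0 × ℝ => P p.1 p.2.1 p.2.2) {s t u c : ℝ≥0} {x : ℝ}
    (hc : 0 < c) (hst : s ≤ t) (htu : c * t ≤ u) (hx : s = 0 → x = 0) {B : Set ℝ}
    (hB : MeasurableSet B) :
    ∫⁻ y, P (c * t) u ((c : ℝ) ^ κ * y) B ∂P s t x = P (c * s) u ((c : ℝ) ^ κ * x) B := by
  have hm : Measurable fun z => P (c * t) u z B :=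
    (Measure.measurable_coe hB).comp
      (measurable_transition_comp hP (by fun_prop) (by fun_prop) (by fun_prop))
  have hx' : c * s = 0 → (c : ℝ) ^ κ * x = 0 := fun h0 => by
    rw [hx ((mul_eq_zero.1 h0).resolve_left hc.ne'), mul_zero]
  rw [← hS.chapman_kolmogorov (c * s) (c * t) u _ (mul_le_mul_right hst c) htu hx' B hB,
    hS.scaling c s t x hc hst hx, lintegral_map hm (by fun_prop)]

theorem IsScalingTransitionSystem.randomised (h : IsSubordinator ν ζ)
    (hP : Measurable fun p : ℝ≥0 × ℝ≥0 × ℝ => P p.1 p.2.1 p.2.2)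
    (hprob : ∀ s t x, s ≤ t → IsProbabilityMeasure (P s t x))
    (hS : IsScalingTransitionSystem κ P) :
    IsScalingTransitionSystem κ
      (randomisedTransition κ (fun u => ν.map (randomFactor ζ u)) P) where
  refl s x hx := by
    rcases eq_or_ne s 0 with rfl | hs
    · rw [randomisedTransition_zero]; exact hS.refl 0 x hx
    · refine Measure.ext fun B hB => ?_
      rw [randomisedTransition_apply h hP (pos_iff_ne_zero.2 hs) s x hB, div_self hs]
      simp_rw [h.randomFactor_one]
      simp [hS.refl s x hx]
  chapman_kolmogorov s t u x hst htu hx B hB := by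
    rcases eq_or_ne t 0 with rfl | ht
    · obtain rfl : s = 0 := le_antisymm hst bot_le
      simp_rw [randomisedTransition_zero]
      exact hS.chapman_kolmogorov 0 0 u x hst htu hx B hB
    have ht := pos_iff_ne_zero.2 ht
    have hu : 0 < u := ht.trans_le htu
    have hRm := h.measurable_randomFactor (u / t)
    -- The second randomised step starts at `R u` rather than at `t`. The dilation `c = R u / t`
    -- carries the end of the first step there and matches the factor applied to the state.
    have hcpos : ∀ ω', 0 < randomFactor ζ (u / t) ω' * u / t := fun ω' =>
      div_pos (mul_pos (randomFactor_pos _ _ _) hu) ht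
    have hct : ∀ ω', randomFactor ζ (u / t) ω' * u / t * t = randomFactor ζ (u / t) ω' * u :=
      fun ω' => div_mul_cancel₀ _ ht.ne'
    have hcu : ∀ ω', randomFactor ζ (u / t) ω' * u / t * t ≤ u := fun ω' => by
      rw [hct]; exact mul_le_of_le_one_left' (h.randomFactor_le_one _ _)
    have hck : ∀ ω', ((u / t : ℝ≥0) : ℝ) ^ κ * (randomFactor ζ (u / t) ω' : ℝ) ^ κ
        = ((randomFactor ζ (u / t) ω' * u / t : ℝ≥0) : ℝ) ^ κ := fun ω' => by
      rw [coe_rpow_mul_coe_rpow]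
      congr 2
      rw [mul_comm, mul_div_assoc]
    have hf : Measurable fun y =>
        randomisedTransition κ (fun u => ν.map (randomFactor ζ u)) P t u y B :=
      (Measure.measurable_coe hB).comp (measurable_transition_comp
        (measurable_randomisedTransition h hP) (by fun_prop) (by fun_prop) (by fun_prop))
    have hj : Measurable fun q : ℝ × Ω₁ => P (randomFactor ζ (u / t) q.2 * u) u
        (((u / t : ℝ≥0) : ℝ) ^ κ * (randomFactor ζ (u / t) q.2 : ℝ) ^ κ * q.1) B :=
      (Measure.measurable_coe hB).comp
        (measurable_transition_comp hP (by fun_prop) (by fun_prop) (by fun_prop))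
    have inner : ∀ s' x', s' ≤ t → (s' = 0 → x' = 0) →
        ∫⁻ y, randomisedTransition κ (fun u => ν.map (randomFactor ζ u)) P t u y B ∂P s' t x'
          = ∫⁻ ω', P (randomFactor ζ (u / t) ω' * u / t * s') u
              (((randomFactor ζ (u / t) ω' * u / t : ℝ≥0) : ℝ) ^ κ * x') B ∂ν := by
      intro s' x' hs' hx'
      have := hprob s' t x' hs'
      simp_rw [randomisedTransition_apply h hP ht u _ hB]
      rw [lintegral_lintegral_swap hj.aemeasurable]
      refine lintegral_congr fun ω' => ?_
      rw [← hS.lintegral_scaled hP (hcpos ω') hs' (hcu ω') hx' hB]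
      simp_rw [hct, hck]
    -- From time `0` and state `0` every dilation is trivial, so the average over `R` has a constant
    -- integrand.
    rcases eq_or_ne s 0 with rfl | hs
    · rw [randomisedTransition_zero, randomisedTransition_zero, inner 0 x hst hx, hx rfl]
      simp
    have hs := pos_iff_ne_zero.2 hs
    rw [lintegral_randomisedTransition h hP hs t x hf]
    have e1 : ∀ ω, ∫⁻ y, randomisedTransition κ (fun u => ν.map (randomFactor ζ u)) P t u y B
          ∂P (randomFactor ζ (t / s) ω * t) t
            (((t / s : ℝ≥0) : ℝ) ^ κ * (randomFactor ζ (t / s) ω : ℝ) ^ κ * x)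
        = ∫⁻ ω', P (randomFactor ζ (t / s) ω * randomFactor ζ (u / t) ω' * u) u
            (((u / s : ℝ≥0) : ℝ) ^ κ
              * ((randomFactor ζ (t / s) ω * randomFactor ζ (u / t) ω' : ℝ≥0) : ℝ) ^ κ * x) B
            ∂ν := by
      intro ω
      rw [inner _ _ (mul_le_of_le_one_left' (h.randomFactor_le_one _ _))
        (fun h0 => absurd h0 (mul_pos (randomFactor_pos _ _ _) ht).ne')]
      refine lintegral_congr fun ω' => ?_
      congr 2
      · field_simp
      · simp only [coe_rpow_mul_coe_rpow, ← mul_assoc]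
        congr 3
        field_simp
    simp_rw [e1]
    have hφ : Measurable fun r : ℝ≥0 =>
        P (r * u) u (((u / s : ℝ≥0) : ℝ) ^ κ * (r : ℝ) ^ κ * x) B :=
      (Measure.measurable_coe hB).comp
        (measurable_transition_comp hP (by fun_prop) (by fun_prop) (by fun_prop))
    rw [randomisedTransition_apply h hP hs u x hB]
    -- The two steps merge into one with the product of independent factors, and `(t/s)(u/t) = u/s`.
    refine (h.lintegral_randomFactor_mul ((one_le_div hs).2 hst) ((one_le_div ht).2 htu)
      hφ).trans ?_
    rw [show t / s * (u / t) = u / s by field_simp]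
  scaling c s t x hc hst hx := by
    rcases eq_or_ne s 0 with rfl | hs
    · rw [mul_zero, randomisedTransition_zero, randomisedTransition_zero]
      have := hS.scaling c 0 t x hc hst hx
      rwa [mul_zero] at this
    · have hs := pos_iff_ne_zero.2 hs
      have hmul : Measurable fun y : ℝ => (c : ℝ) ^ κ * y := by fun_prop
      refine Measure.ext fun B hB => ?_
      rw [Measure.map_apply hmul hB, randomisedTransition_apply h hP hs t x (hmul hB),
        randomisedTransition_apply h hP (mul_pos hc hs) (c * t) _ hB,
        mul_div_mul_left _ _ hc.ne']
      refine lintegral_congr fun ω => ?_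
      rw [← Measure.map_apply hmul hB, ← hS.scaling c _ t _ hc
        (mul_le_of_le_one_left' (h.randomFactor_le_one _ _))
        (fun h0 => absurd h0 (mul_pos (randomFactor_pos _ _ _) (hs.trans_le hst)).ne')]
      congr 2
      · ring
      · ring

end

/-! ### The transition function of the subordinated process -/

section

variable {Ω Ω₁ : Type*} [MeasurableSpace Ω] [MeasurableSpace Ω₁] {μ : Measure Ω}
  [IsProbabilityMeasure μ] {ν : Measure Ω₁} [IsProbabilityMeasure ν] {κ : ℝ} {Z : ℝ≥0 → Ω → ℝ}
  {ζ : ℝ≥0 → Ω₁ → ℝ} {P : ℝ≥0 → ℝ≥0 → ℝ → Measure ℝ}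

theorem IsTransitionFunctionOf.lintegral (hP : IsTransitionFunctionOf μ Z P)
    (hZ : ∀ t, Measurable (Z t)) {s t : ℝ≥0} (hst : s ≤ t) {H : ℝ × ℝ → ℝ≥0∞} (hH : Measurable H) :
    ∫⁻ ω, H (Z s ω, Z t ω) ∂μ = ∫⁻ ω, ∫⁻ y, H (Z s ω, y) ∂P s t (Z s ω) ∂μ := by
  have h1 := compProd_map_condDistrib (μ := μ) (mβ := inferInstance) (X := Z s) (hZ t).aemeasurable
  rw [← lintegral_map hH ((hZ s).prodMk (hZ t)), ← h1, Measure.lintegral_compProd hH,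
    lintegral_map hH.lintegral_kernel_prod_right' (hZ s)]
  refine lintegral_congr_ae ?_
  filter_upwards [ae_of_ae_map (hZ s).aemeasurable (hP.condDistrib s t hst)] with ω hω
  rw [hω]

theorem IsSelfSimilar.lintegral_scale (h : IsSelfSimilar κ μ Z) (hZ : ∀ t, Measurable (Z t))
    {c : ℝ≥0} (hc : 0 < c) (t : ℝ≥0) {f : ℝ → ℝ≥0∞} (hf : Measurable f) :
    ∫⁻ ω, f ((c : ℝ) ^ κ * Z t ω) ∂μ = ∫⁻ ω, f (Z (c * t) ω) ∂μ := by
  have key := congrArg (fun ν => ∫⁻ z, f (z t) ∂ν) (h.map_eq hZ hc)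
  have hft : Measurable fun z : ℝ≥0 → ℝ => f (z t) := hf.comp (measurable_pi_apply t)
  rw [lintegral_map hft (measurable_pi_lambda _ fun _ => hZ _),
    lintegral_map hft (measurable_pi_lambda _ fun _ => (hZ _).const_mul _)] at key
  exact key.symm

/-- A process with the two-dimensional laws of the subordinated process has the randomised
transition function. -/
theorem IsTransitionFunctionOf.randomised {Ω' : Type*} [MeasurableSpace Ω'] {μ' : Measure Ω'}
    [IsProbabilityMeasure μ'] {X : ℝ≥0 → Ω' → ℝ} (hX : ∀ t, Measurable (X t)) (hX0 : ∀ ω, X 0 ω = 0)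
    (hκ : 0 < κ) (hZ : ∀ t, Measurable (Z t)) (hZj : Measurable fun p : ℝ≥0 × Ω => Z p.1 p.2)
    (hss : IsSelfSimilar κ μ Z) (hζ : IsSubordinator ν ζ)
    (hmarg : ∀ t, μ'.map (X t) = μ.map (Z t))
    (hpair : ∀ s t : ℝ≥0, 0 < s → s ≤ t → ∀ h : ℝ, μ'.map (fun p => (X s p, X t p))
      = (μ.prod (ν.map (ζ (Real.log t - Real.log s).toNNReal))).map (fun p =>
        ((s : ℝ) ^ κ * lamperti κ Z (h - p.2) p.1, (t : ℝ) ^ κ * lamperti κ Z h p.1)))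
    (hP : IsTransitionFunctionOf μ Z P) :
    IsTransitionFunctionOf μ' X
      (randomisedTransition κ (fun u => ν.map (randomFactor ζ u)) P) where
  measurable := measurable_randomisedTransition hζ hP.measurable
  isProbabilityMeasure :=
    isProbabilityMeasure_randomisedTransition hζ hP.measurable hP.isProbabilityMeasure
  condDistrib s t hst := by
    set Pt := randomisedTransition κ (fun u => ν.map (randomFactor ζ u)) P with hPt
    let K : Kernel ℝ ℝ :=
      { toFun := Pt s t
        measurable' := measurable_transition_comp (measurable_randomisedTransition hζ hP.measurable)
          measurable_const measurable_const measurable_id }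
    have hK : IsMarkovKernel K := ⟨fun x =>
      isProbabilityMeasure_randomisedTransition hζ hP.measurable hP.isProbabilityMeasure s t x hst⟩
    suffices hs : μ'.map (fun p => (X s p, X t p)) = μ'.map (X s) ⊗ₘ K by
      filter_upwards [condDistrib_ae_eq_of_measure_eq_compProd _ (hX t).aemeasurable hs] with x hx
      exact hx.symm
    refine Measure.ext_of_lintegral _ fun H hH => ?_
    rw [Measure.lintegral_compProd hH, hmarg s,
      lintegral_map hH.lintegral_kernel_prod_right' (hZ s)]
    change _ = ∫⁻ ω, ∫⁻ y, H (Z s ω, y) ∂Pt s t (Z s ω) ∂μ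
    rcases eq_or_ne s 0 with rfl | hs
    · simp_rw [hPt, randomisedTransition_zero]
      rw [← hP.lintegral hZ hst hH, lintegral_map hH ((hX 0).prodMk (hX t))]
      simp_rw [hX0]
      have hH0 : Measurable fun y => H (0, y) := hH.comp measurable_prodMk_left
      rw [← lintegral_map hH0 (hX t), hmarg t, lintegral_map hH0 (hZ t)]
      refine lintegral_congr_ae ?_
      filter_upwards [hss.zero_ae_eq_zero hκ hZ] with ω hω
      rw [hω]
      rfl
    have hs := pos_iff_ne_zero.2 hs
    have ht := hs.trans_le hst
    have hs' : (0 : ℝ) < s := hs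
    have ht' : (0 : ℝ) < t := ht
    have hV := measurable_lamperti (κ := κ) hZj
    have hr : Measurable fun p : Ω × ℝ => ((s : ℝ) ^ κ * lamperti κ Z (Real.log t - p.2) p.1,
        (t : ℝ) ^ κ * lamperti κ Z (Real.log t) p.1) :=
      ((hV.comp ((measurable_snd.const_sub _).prodMk measurable_fst)).const_mul _).prodMk
        ((hV.comp (measurable_const.prodMk measurable_fst)).const_mul _)
    have := Measure.isProbabilityMeasure_map (μ := ν)
      (hζ.measurable (Real.log t - Real.log s).toNNReal).aemeasurable
    -- The choice `h = log t` makes the second coordinate exactly `Z t`, so that for a frozen factor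
    -- the transition function of `Z` from `R t` to `t` can be used.
    rw [hpair s t hs hst (Real.log t), lintegral_map hH hr,
      lintegral_prod_symm (fun p : Ω × ℝ => H ((s : ℝ) ^ κ * lamperti κ Z (Real.log t - p.2) p.1,
        (t : ℝ) ^ κ * lamperti κ Z (Real.log t) p.1)) (hH.comp hr).aemeasurable,
      lintegral_map (f := fun d => ∫⁻ ω, H ((s : ℝ) ^ κ * lamperti κ Z (Real.log t - d) ω,
        (t : ℝ) ^ κ * lamperti κ Z (Real.log t) ω) ∂μ) (hH.comp hr).lintegral_prod_left'
        (hζ.measurable _)]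
    set R : Ω₁ → ℝ≥0 := randomFactor ζ (t / s)
    have hRm : Measurable R := hζ.measurable_randomFactor _
    have hR1 : ∀ ω, R ω ≤ 1 := hζ.randomFactor_le_one _
    have hlog : Real.log t - Real.log s = Real.log (t / s : ℝ≥0) := by
      rw [NNReal.coe_div, Real.log_div ht'.ne' hs'.ne']
    let L : Kernel (ℝ × Ω₁) ℝ :=
      { toFun := fun q => P (R q.2 * t) t (((t / s : ℝ≥0) : ℝ) ^ κ * (R q.2 : ℝ) ^ κ * q.1)
        measurable' := measurable_transition_comp hP.measurable (by fun_prop) (by fun_prop)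
          (by fun_prop) }
    have hL : IsMarkovKernel L := ⟨fun q =>
      hP.isProbabilityMeasure _ _ _ (mul_le_of_le_one_left' (hR1 _))⟩
    have hstep : ∀ ω₁, ∫⁻ ω, H ((s : ℝ) ^ κ
          * lamperti κ Z (Real.log t - ζ (Real.log t - Real.log s).toNNReal ω₁) ω,
          (t : ℝ) ^ κ * lamperti κ Z (Real.log t) ω) ∂μ
        = ∫⁻ ω, ∫⁻ y, H (Z s ω, y) ∂L (Z s ω, ω₁) ∂μ := by
      intro ω₁
      have hRpos : 0 < R ω₁ := randomFactor_pos _ _ _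
      have hexp : (Real.exp (-ζ (Real.log t - Real.log s).toNNReal ω₁)).toNNReal = R ω₁ := by
        rw [hlog]; rfl
      have hexp' : Real.exp (-ζ (Real.log t - Real.log s).toNNReal ω₁) = R ω₁ := by
        rw [hlog]; exact (coe_randomFactor _ _ _).symm
      simp_rw [rpow_mul_lamperti hs ht, rpow_mul_lamperti_log ht, hexp, hexp']
      -- Since `c · R t = s`, self-similarity replaces `c^κ Z_{Rt}` by `Z_s`. In terms of this new
      -- state the starting point of `P` is `c^{-κ} = (t/s)^κ R^κ` times it.
      set c : ℝ≥0 := s / (t * R ω₁) with hc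
      have hc0 : 0 < c := div_pos hs (mul_pos ht hRpos)
      have hcc : ((s : ℝ) / (t * R ω₁)) = c := by simp [hc]
      rw [hcc]
      have hH' : Measurable fun q : ℝ × ℝ => H ((c : ℝ) ^ κ * q.1, q.2) := by fun_prop
      rw [hP.lintegral hZ (mul_le_of_le_one_left' (hR1 ω₁)) hH']
      have hg : Measurable fun x => ∫⁻ y, H (x, y) ∂L (x, ω₁) := by
        have hcomap : Measurable fun x : ℝ => (x, ω₁) := measurable_prodMk_right
        exact hH.lintegral_kernel_prod_right' (κ := L.comap (fun x => (x, ω₁)) hcomap)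
      have hct : c * (R ω₁ * t) = s := by
        rw [hc]; field_simp
      rw [show ∫⁻ ω, ∫⁻ y, H (Z s ω, y) ∂L (Z s ω, ω₁) ∂μ
        = ∫⁻ ω, (fun x => ∫⁻ y, H (x, y) ∂L (x, ω₁)) (Z (c * (R ω₁ * t)) ω) ∂μ by rw [hct],
        ← hss.lintegral_scale hZ hc0 _ hg]
      refine lintegral_congr fun ω => ?_
      simp only
      congr 1
      change _ = P _ _ _
      congr 1
      rw [coe_rpow_mul_coe_rpow, ← mul_assoc, coe_rpow_mul_coe_rpow]
      rw [show t / s * R ω₁ * c = 1 by rw [hc]; field_simp]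
      simp
    simp_rw [hstep]
    have hj : Measurable fun q : Ω × Ω₁ => ∫⁻ y, H (Z s q.1, y) ∂L (Z s q.1, q.2) := by
      have h1 : Measurable fun q : (ℝ × Ω₁) × ℝ => H (q.1.1, q.2) := by fun_prop
      have h2 : Measurable fun q : ℝ × Ω₁ => ∫⁻ y, H (q.1, y) ∂L q :=
        h1.lintegral_kernel_prod_right'
      exact h2.comp (((hZ s).comp measurable_fst).prodMk measurable_snd)
    rw [lintegral_lintegral_swap
      (f := fun a ω => ∫⁻ y, H (Z s ω, y) ∂L (Z s ω, a)) (hj.comp measurable_swap).aemeasurable]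
    refine lintegral_congr fun ω => ?_
    exact (lintegral_randomisedTransition (f := fun y => H (Z s ω, y)) hζ hP.measurable hs t _
      (hH.comp measurable_prodMk_left)).symm

end

/-! ### Path regularity -/

/-- A right-continuous nondecreasing function composed with a càdlàg one has right limits and left
limits. -/
theorem isCadlagAt_comp_monotone {f : ℝ≥0 → ℝ} {τ : ℝ≥0 → ℝ≥0} {t : ℝ≥0}
    (hf : ∀ s, IsCadlagAt f s) (hτ : MonotoneOn τ (Ioi 0)) (ht : 0 < t)
    (hτc : ContinuousWithinAt τ (Ici t) t) : IsCadlagAt (fun s => f (τ s)) t ∧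
      ∃ l, (∀ s, 0 < s → s < t → τ s ≤ l) ∧ Tendsto τ (𝓝[<] t) (𝓝 l) := by
  have hbdd : BddAbove (τ '' Ioo 0 t) := ⟨τ t, by
    rintro _ ⟨s, hs, rfl⟩
    exact hτ hs.1 ht hs.2.le⟩
  set l := sSup (τ '' Ioo 0 t)
  have hle : ∀ s, 0 < s → s < t → τ s ≤ l := fun s h1 h2 => le_csSup hbdd ⟨s, ⟨h1, h2⟩, rfl⟩
  have hne : (τ '' Ioo 0 t).Nonempty := (nonempty_Ioo.2 ht).image τ
  have hev : ∀ s, s < t → ∀ᶠ x in 𝓝[<] t, s ≤ x ∧ x < t := fun s h2 => by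
    filter_upwards [mem_nhdsWithin_of_mem_nhds (Ici_mem_nhds h2), self_mem_nhdsWithin] with x hx hx'
    exact ⟨hx, hx'⟩
  have hlim : Tendsto τ (𝓝[<] t) (𝓝 l) := by
    refine tendsto_order.2 ⟨fun a ha => ?_, fun a ha => ?_⟩
    · obtain ⟨_, ⟨s, hs, rfl⟩, has⟩ := exists_lt_of_lt_csSup hne ha
      filter_upwards [hev s hs.2] with x hx
      exact has.trans_le (hτ hs.1 (hs.1.trans_le hx.1) hx.1)
    · obtain ⟨s, hs⟩ := nonempty_Ioo.2 ht
      filter_upwards [hev s hs.2] with x hx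
      exact (hle x (hs.1.trans_le hx.1) hx.2).trans_lt ha
  refine ⟨⟨(hf (τ t)).1.comp hτc fun s hs => hτ ht (ht.trans_le hs) hs, ?_⟩, l, hle, hlim⟩
  -- If `τ` attains its left limit `l` before `t`, it is constant just before `t` and the limit is
  -- `f l`. Otherwise it approaches `l` strictly from below and the left limit of `f` at `l` is
  -- found.
  by_cases hatt : ∃ s, 0 < s ∧ s < t ∧ τ s = l
  · obtain ⟨s, h1, h2, h3⟩ := hatt
    refine ⟨f l, tendsto_const_nhds.congr' ?_⟩
    filter_upwards [hev s h2] with x hx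
    congr 1
    exact le_antisymm (h3 ▸ hτ h1 (h1.trans_le hx.1) hx.1) (hle x (h1.trans_le hx.1) hx.2)
  · push Not at hatt
    obtain ⟨k, hk⟩ := (hf l).2
    refine ⟨k, hk.comp (tendsto_nhdsWithin_iff.2 ⟨hlim, ?_⟩)⟩
    obtain ⟨s, hs⟩ := nonempty_Ioo.2 ht
    filter_upwards [hev s hs.2] with x hx
    have hx0 := hs.1.trans_le hx.1
    exact lt_of_le_of_ne (hle x hx0 hx.2) (hatt x hx0 hx.2)

/-- The subordinated process is càdlàg away from time `0`. -/
theorem isCadlagAt_lampertiInv_subordinate {Ω Ω₂ : Type*} {κ : ℝ} {Z : ℝ≥0 → Ω → ℝ}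
    (hZ : ∀ ω t, IsCadlagAt (fun t => Z t ω) t) {η : ℝ → Ω₂ → ℝ}
    (hηm : ∀ ω, Monotone fun a => η a ω)
    (hηc : ∀ ω a, ContinuousWithinAt (fun a => η a ω) (Ici a) a) (p : Ω × Ω₂) {t : ℝ≥0}
    (ht : 0 < t) :
    IsCadlagAt (fun t => lampertiInv κ (subordinate (lamperti κ Z) η) t p) t := by
  -- In this clock the process is `(t/τ_t)^κ Z_{τ_t}`.
  set τ : ℝ≥0 → ℝ≥0 := fun t => (Real.exp (η (Real.log t) p.2)).toNNReal
  have hτpos : ∀ s, 0 < τ s := fun s => Real.toNNReal_pos.2 (Real.exp_pos _)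
  have hmono : MonotoneOn τ (Ioi 0) := fun a ha b _ hab => Real.toNNReal_mono
    (Real.exp_le_exp.2 (hηm _ (Real.log_le_log (NNReal.coe_pos.2 ha) hab)))
  have hlogc : ContinuousAt (fun s : ℝ≥0 => Real.log s) t :=
    (Real.continuousAt_log (NNReal.coe_pos.2 ht).ne').comp NNReal.continuous_coe.continuousAt
  have hc : ContinuousWithinAt τ (Ici t) t := by
    refine (continuous_real_toNNReal.comp Real.continuous_exp).continuousAt.comp_continuousWithinAt
      (ContinuousWithinAt.comp (f := fun s : ℝ≥0 => Real.log s) (hηc p.2 (Real.log t))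
        hlogc.continuousWithinAt fun s hs => ?_)
    exact Real.log_le_log (NNReal.coe_pos.2 ht) hs
  obtain ⟨⟨h1, l, h2⟩, k, hk, hkl⟩ := isCadlagAt_comp_monotone (hZ p.1) hmono ht hc
  -- The left limit of the clock dominates earlier positive values, so the factor `(t/τ_t)^κ` has a
  -- finite left limit too.
  have hk0 : 0 < k := by
    obtain ⟨s, hs⟩ := nonempty_Ioo.2 ht
    exact (hτpos s).trans_le (hk s hs.1 hs.2)
  have hform : ∀ s : ℝ≥0, 0 < s → ((s : ℝ) / τ s) ^ κ * Z (τ s) p.1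
      = lampertiInv κ (subordinate (lamperti κ Z) η) s p := by
    intro s hs
    have hcoe : (τ s : ℝ) = Real.exp (η (Real.log s) p.2) := Real.coe_toNNReal _ (Real.exp_pos _).le
    rw [lampertiInv_of_pos hs]
    change _ = (s : ℝ) ^ κ * (Real.exp (-(κ * η (Real.log s) p.2)) * Z (τ s) p.1)
    rw [hcoe, Real.div_rpow s.coe_nonneg
      (Real.exp_pos _).le, ← Real.exp_mul, Real.exp_neg, mul_comm κ, ← mul_assoc, div_eq_mul_inv]
  have hfac : ∀ {F : Filter ℝ≥0} {x : ℝ≥0}, F ≤ 𝓝 t → Tendsto τ F (𝓝 x) → 0 < x →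
      Tendsto (fun s : ℝ≥0 => ((s : ℝ) / τ s) ^ κ) F (𝓝 (((t : ℝ) / x) ^ κ)) := by
    intro F x hF hx hx0
    refine Tendsto.rpow_const (Tendsto.div ((NNReal.continuous_coe.tendsto t).mono_left hF)
      ((NNReal.continuous_coe.tendsto x).comp hx) (NNReal.coe_pos.2 hx0).ne') (Or.inl ?_)
    exact (div_pos (NNReal.coe_pos.2 ht) (NNReal.coe_pos.2 hx0)).ne'
  refine ⟨?_, ((t : ℝ) / k) ^ κ * l, ?_⟩
  · have := (hfac nhdsWithin_le_nhds hc.tendsto (hτpos t)).mul h1.tendsto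
    rw [hform t ht] at this
    refine this.congr' ?_
    filter_upwards [self_mem_nhdsWithin] with s hs
    exact hform s (ht.trans_le hs)
  · refine ((hfac nhdsWithin_le_nhds hkl hk0).mul h2).congr' ?_
    filter_upwards [mem_nhdsWithin_of_mem_nhds (Ioi_mem_nhds ht)] with s hs
    exact hform s hs

/-! ### Martingales near time `0` -/

/-- Doob's maximal inequality for a right-continuous martingale in continuous time. -/
theorem MeasureTheory.Martingale.measure_exists_lt_abs_le {Ω : Type*} {m : MeasurableSpace Ω}
    {μ : Measure Ω} [IsFiniteMeasure μ] {X : ℝ≥0 → Ω → ℝ} {F : Filtration ℝ≥0 m}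
    (hX : Martingale X F μ)
    (hr : ∀ ω t, 0 < t → ContinuousWithinAt (fun t => X t ω) (Ici t) t) {δ : ℝ≥0} (hδ : 0 < δ)
    (ε : ℝ≥0) :
    ε * μ {ω | ∃ t, 0 < t ∧ t < δ ∧ (ε : ℝ) < |X t ω|} ≤ ENNReal.ofReal (∫ ω, |X δ ω| ∂μ) := by
  -- Equal subdivisions of `[0, δ]`, whose last point `k = n + 1` is `δ`; the discrete maximal
  -- inequality is applied to `|X|` along each.
  let τ : ℕ → ℕ → ℝ≥0 := fun n k => k * δ / (n + 1)
  have hτ : ∀ n, Monotone (τ n) := fun n i j hij => by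
    simp only [τ]; gcongr
  have hτδ : ∀ n, τ n (n + 1) = δ := fun n => by
    simp only [τ]; push_cast; field_simp
  let A : ℕ → Set Ω := fun n =>
    {ω | (ε : ℝ) ≤ (Finset.range (n + 1 + 1)).sup' Finset.nonempty_range_add_one
      fun k => |X (τ n k) ω|}
  have hA : ∀ n, ε * μ (A n) ≤ ENNReal.ofReal (∫ ω, |X δ ω| ∂μ) := by
    intro n
    let 𝒢 : Filtration ℕ m :=
      { seq := fun k => F (τ n k)
        mono' := fun i j hij => F.mono (hτ n hij)
        le' := fun k => F.le _ }
    have hM : Martingale (fun k => X (τ n k)) 𝒢 μ :=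
      ⟨fun k => hX.1 (τ n k), fun i j hij => hX.2 _ _ (hτ n hij)⟩
    have hsub : Submartingale (fun k ω => |X (τ n k) ω|) 𝒢 μ :=
      hM.submartingale.sup hM.neg.submartingale
    refine (maximal_ineq hsub (fun k ω => abs_nonneg _) (n + 1)).trans (ENNReal.ofReal_le_ofReal ?_)
    rw [hτδ]
    exact setIntegral_le_integral (hX.integrable δ).abs (ae_of_all _ fun ω => abs_nonneg _)
  -- Rounding `t` up to the grid, right-continuity keeps the strict inequality for all large `n`.
  -- The grids are not nested, so the event is placed in the lower limit of the `A n`.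
  have hsubset : {ω | ∃ t, 0 < t ∧ t < δ ∧ (ε : ℝ) < |X t ω|} ⊆ ⋃ n, ⋂ k ≥ n, A k := by
    rintro ω ⟨t, ht, htδ, hε⟩
    let g : ℕ → ℕ := fun n => ⌈t * ((n : ℝ≥0) + 1) / δ⌉₊
    have hge : ∀ n, t ≤ τ n (g n) := fun n => by
      have h := Nat.le_ceil (t * ((n : ℝ≥0) + 1) / δ)
      rw [div_le_iff₀ hδ] at h
      simp only [τ]
      rw [le_div_iff₀ (by positivity)]
      exact h
    have hle : ∀ n, τ n (g n) ≤ t + δ * (1 / ((n : ℝ≥0) + 1)) := fun n => by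
      have h := (Nat.ceil_lt_add_one (bot_le : 0 ≤ t * ((n : ℝ≥0) + 1) / δ)).le
      simp only [τ]
      rw [div_le_iff₀ (by positivity)]
      calc (g n : ℝ≥0) * δ ≤ (t * ((n : ℝ≥0) + 1) / δ + 1) * δ := by gcongr
        _ = _ := by field_simp
    have hgn : ∀ n, g n ∈ Finset.range (n + 1 + 1) := fun n => by
      rw [Finset.mem_range, Nat.lt_succ_iff]
      refine Nat.ceil_le.2 ?_
      rw [div_le_iff₀ hδ, mul_comm]
      push_cast
      gcongr
    have hlim : Tendsto (fun n => τ n (g n)) atTop (𝓝[≥] t) := by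
      refine tendsto_nhdsWithin_iff.2 ⟨?_, Eventually.of_forall hge⟩
      refine tendsto_of_tendsto_of_tendsto_of_le_of_le tendsto_const_nhds ?_ hge hle
      have h := (tendsto_one_div_add_atTop_nhds_zero_nat (𝕜 := ℝ≥0)).const_mul δ
      simpa using h.const_add t
    have hev := ((hr ω t ht).tendsto.comp hlim).abs.eventually (lt_mem_nhds hε)
    obtain ⟨n, hn⟩ := eventually_atTop.1 hev
    refine mem_iUnion.2 ⟨n, mem_iInter₂.2 fun k hk => ?_⟩
    exact (hn k hk).le.trans (Finset.le_sup' (fun k' => |X (τ k k') ω|) (hgn k))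
  have hmono : Monotone fun n => ⋂ k ≥ n, A k := fun i j hij =>
    biInter_mono (fun k (hk : k ≥ j) => hij.trans hk) fun _ _ => Subset.rfl
  calc ε * μ {ω | ∃ t, 0 < t ∧ t < δ ∧ (ε : ℝ) < |X t ω|}
      ≤ ε * μ (⋃ n, ⋂ k ≥ n, A k) := by gcongr
    _ = ⨆ n, ε * μ (⋂ k ≥ n, A k) := by rw [hmono.measure_iUnion, ENNReal.mul_iSup]
    _ ≤ ENNReal.ofReal (∫ ω, |X δ ω| ∂μ) := iSup_le fun n => by
      refine le_trans ?_ (hA n)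
      gcongr
      exact biInter_subset_of_mem (mem_Ici.2 le_rfl : n ∈ {k | k ≥ n})

/-- A right-continuous martingale that tends to `0` in `L¹` as `t ↓ 0` does so almost surely. -/
theorem MeasureTheory.Martingale.ae_tendsto_zero {Ω : Type*} {m : MeasurableSpace Ω}
    {μ : Measure Ω} [IsFiniteMeasure μ] {X : ℝ≥0 → Ω → ℝ} {F : Filtration ℝ≥0 m}
    (hX : Martingale X F μ)
    (hr : ∀ ω t, 0 < t → ContinuousWithinAt (fun t => X t ω) (Ici t) t)
    (h0 : Tendsto (fun t => ∫ ω, |X t ω| ∂μ) (𝓝[>] 0) (𝓝 0)) :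
    ∀ᵐ ω ∂μ, Tendsto (fun t => X t ω) (𝓝[>] 0) (𝓝 0) := by
  have key : ∀ n : ℕ, ∀ᵐ ω ∂μ, ∃ δ : ℝ≥0, 0 < δ ∧
      ∀ t, 0 < t → t < δ → |X t ω| ≤ ((1 / ((n : ℝ≥0) + 1) : ℝ≥0) : ℝ) := by
    intro n
    set ε : ℝ≥0 := 1 / ((n : ℝ≥0) + 1) with hε
    have hε0 : (ε : ℝ≥0∞) ≠ 0 := by
      rw [hε]; exact ENNReal.coe_ne_zero.2 (by positivity)
    -- The set on the left does not depend on the outer `δ`, while the bound tends to `0`; hence it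
    -- is null.
    have hbound : ∀ᶠ δ in 𝓝[>] (0 : ℝ≥0),
        ε * μ {ω | ¬ ∃ δ : ℝ≥0, 0 < δ ∧ ∀ t, 0 < t → t < δ → |X t ω| ≤ (ε : ℝ)}
          ≤ ENNReal.ofReal (∫ ω, |X δ ω| ∂μ) := by
      filter_upwards [self_mem_nhdsWithin] with δ hδ
      refine le_trans ?_ (hX.measure_exists_lt_abs_le hr hδ ε)
      gcongr with ω
      intro hω
      push Not at hω
      obtain ⟨t, h1, h2, h3⟩ := hω δ hδ
      exact ⟨t, h1, h2, h3⟩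
    have hle := ge_of_tendsto (ENNReal.tendsto_ofReal h0) hbound
    rw [ENNReal.ofReal_zero, nonpos_iff_eq_zero, mul_eq_zero] at hle
    exact hle.resolve_left hε0
  filter_upwards [ae_all_iff.2 key] with ω hω
  refine Metric.tendsto_nhds.2 fun ε hε => ?_
  obtain ⟨n, hn⟩ := exists_nat_one_div_lt hε
  obtain ⟨δ, hδ, h⟩ := hω n
  filter_upwards [Ioo_mem_nhdsGT hδ] with t ht
  rw [Real.dist_eq, sub_zero]
  refine (h t ht.1 ht.2).trans_lt ?_
  push_cast
  exact hn

/-! ### The martingale property -/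

section

variable {Ω Ω₁ Ω' : Type*} [MeasurableSpace Ω] [MeasurableSpace Ω₁] {μ : Measure Ω}
  [IsProbabilityMeasure μ] {ν : Measure Ω₁} [IsProbabilityMeasure ν] {κ : ℝ} {Z : ℝ≥0 → Ω → ℝ}
  {ζ : ℝ≥0 → Ω₁ → ℝ} [MeasurableSpace Ω'] {μ' : Measure Ω'} [IsProbabilityMeasure μ']
  {X : ℝ≥0 → Ω' → ℝ}

theorem IsSelfSimilar.integral_scale (h : IsSelfSimilar κ μ Z) (hZ : ∀ t, Measurable (Z t))
    {c : ℝ≥0} (hc : 0 < c) (t : ℝ≥0) {f : ℝ → ℝ} (hf : Measurable f) :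
    ∫ ω, f ((c : ℝ) ^ κ * Z t ω) ∂μ = ∫ ω, f (Z (c * t) ω) ∂μ := by
  have key := congrArg (Measure.map fun z : ℝ≥0 → ℝ => z t) (h.map_eq hZ hc)
  rw [Measure.map_map (measurable_pi_apply _) (measurable_pi_lambda _ fun _ => hZ _),
    Measure.map_map (measurable_pi_apply _)
      (measurable_pi_lambda _ fun _ => (hZ _).const_mul _)] at key
  change μ.map (Z (c * t)) = μ.map (fun ω => (c : ℝ) ^ κ * Z t ω) at key
  rw [← integral_map (hZ _).aemeasurable hf.aestronglyMeasurable, key,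
    integral_map ((hZ _).const_mul _).aemeasurable hf.aestronglyMeasurable]

theorem integrable_of_map_eq (hX : ∀ t, Measurable (X t)) (hZ : ∀ t, Measurable (Z t))
    {t : ℝ≥0} (hmarg : μ'.map (X t) = μ.map (Z t)) (hi : Integrable (Z t) μ) :
    Integrable (X t) μ' := by
  have h1 : Integrable id (μ.map (Z t)) :=
    (integrable_map_measure aestronglyMeasurable_id (hZ t).aemeasurable).2 hi
  rw [← hmarg] at h1
  exact (integrable_map_measure aestronglyMeasurable_id (hX t).aemeasurable).1 h1

theorem integral_of_map_eq (hX : ∀ t, Measurable (X t)) (hZ : ∀ t, Measurable (Z t))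
    {t : ℝ≥0} (hmarg : μ'.map (X t) = μ.map (Z t)) {f : ℝ → ℝ} (hf : Measurable f) :
    ∫ p, f (X t p) ∂μ' = ∫ ω, f (Z t ω) ∂μ := by
  rw [← integral_map (hX t).aemeasurable hf.aestronglyMeasurable, hmarg,
    integral_map (hZ t).aemeasurable hf.aestronglyMeasurable]

theorem setIntegral_preimage_eq {α : Type*} [MeasurableSpace α] (ρ : Measure α) {Y : α → ℝ}
    (hY : Measurable Y) {A : Set ℝ} (hA : MeasurableSet A) (W : α → ℝ) :
    ∫ x in Y ⁻¹' A, W x ∂ρ = ∫ x, A.indicator 1 (Y x) * W x ∂ρ := by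
  rw [← integral_indicator (hY hA)]
  refine integral_congr_ae (ae_of_all _ fun x => ?_)
  by_cases hx : Y x ∈ A <;> simp [hx]

/-- The averaging identity behind the martingale property of the subordinated process. -/
theorem setIntegral_eq_of_map_prodMk (hX : ∀ t, Measurable (X t)) (hZ : ∀ t, Measurable (Z t))
    (hZj : Measurable fun p : ℝ≥0 × Ω => Z p.1 p.2) (hss : IsSelfSimilar κ μ Z)
    (hζ : IsSubordinator ν ζ)
    (hκζ : ∀ a : ℝ≥0, ∫ ω, Real.exp (-(κ * ζ a ω)) ∂ν = Real.exp (-(a * κ)))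
    (hmarg : ∀ t, μ'.map (X t) = μ.map (Z t)) (hM : Martingale Z (naturalFiltration Z hZ) μ)
    {s t : ℝ≥0} (hs : 0 < s) (hst : s ≤ t)
    (hpair : μ'.map (fun p => (X s p, X t p))
      = (μ.prod (ν.map (ζ (Real.log t - Real.log s).toNNReal))).map (fun p =>
        ((s : ℝ) ^ κ * lamperti κ Z (Real.log t - p.2) p.1,
          (t : ℝ) ^ κ * lamperti κ Z (Real.log t) p.1))) {A : Set ℝ} (hA : MeasurableSet A) :
    ∫ p in X s ⁻¹' A, X t p ∂μ' = ∫ p in X s ⁻¹' A, X s p ∂μ' := by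
  have ht := hs.trans_le hst
  have hs' : (0 : ℝ) < s := hs
  have ht' : (0 : ℝ) < t := ht
  set a : ℝ≥0 := (Real.log t - Real.log s).toNNReal
  have haR : (a : ℝ) = Real.log t - Real.log s :=
    Real.coe_toNNReal _ (sub_nonneg.2 (Real.log_le_log hs' hst))
  have := Measure.isProbabilityMeasure_map (μ := ν) (hζ.measurable a).aemeasurable
  set f : ℝ → ℝ := A.indicator 1 with hf
  have hfm : Measurable f := measurable_one.indicator hA
  have hf1 : ∀ x, ‖f x‖ ≤ 1 := fun x => by
    by_cases hx : x ∈ A <;> simp [hf, hx]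
  have hH : Measurable fun x : ℝ × ℝ => f x.1 * x.2 :=
    (hfm.comp measurable_fst).mul measurable_snd
  have hV := measurable_lamperti (κ := κ) hZj
  have hr : Measurable fun p : Ω × ℝ => ((s : ℝ) ^ κ * lamperti κ Z (Real.log t - p.2) p.1,
      (t : ℝ) ^ κ * lamperti κ Z (Real.log t) p.1) :=
    ((hV.comp ((measurable_snd.const_sub _).prodMk measurable_fst)).const_mul _).prodMk
      ((hV.comp (measurable_const.prodMk measurable_fst)).const_mul _)
  -- For a frozen factor `r`, the martingale property replaces `Z_t` by `Z_{rt}` and self-similarity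
  -- turns the result into `c^{-κ} E[f(Z_s) Z_s]`, with `c^{-κ} = (t/s)^κ r^κ`. Only `r^κ` remains
  -- to be averaged, and `hκζ` says that its mean is `(s/t)^κ`.
  have hinner : ∀ ω₁, ∫ ω, f ((s : ℝ) ^ κ * lamperti κ Z (Real.log t - ζ a ω₁) ω)
        * ((t : ℝ) ^ κ * lamperti κ Z (Real.log t) ω) ∂μ
      = ((t : ℝ) / s) ^ κ * (∫ ω, f (Z s ω) * Z s ω ∂μ) * Real.exp (-(κ * ζ a ω₁)) := by
    intro ω₁
    set r : ℝ≥0 := (Real.exp (-ζ a ω₁)).toNNReal with hr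
    have hr0 : 0 < r := Real.toNNReal_pos.2 (Real.exp_pos _)
    have hr1 : r ≤ 1 := by
      rw [hr, Real.toNNReal_le_one, Real.exp_le_one_iff, neg_nonpos]
      exact hζ.nonneg a ω₁
    have hrR : Real.exp (-ζ a ω₁) = r := (Real.coe_toNNReal _ (Real.exp_pos _).le).symm
    have hrκ : Real.exp (-(κ * ζ a ω₁)) = (r : ℝ) ^ κ := by
      rw [← hrR, ← Real.exp_mul]; ring_nf
    simp_rw [rpow_mul_lamperti hs ht, rpow_mul_lamperti_log ht]
    rw [hrR, Real.toNNReal_coe]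
    set c : ℝ≥0 := s / (t * r) with hc
    have hc0 : 0 < c := div_pos hs (mul_pos ht hr0)
    have hcR : (s : ℝ) / (t * r) = c := by simp [hc]
    have hct : c * (r * t) = s := by rw [hc]; field_simp
    have hY : Measurable[naturalFiltration Z hZ (r * t)]
        fun ω => (c : ℝ) ^ κ * Z (r * t) ω := (hM.1 (r * t)).measurable.const_mul _
    have hfx : Measurable fun x : ℝ => f x * x := hfm.mul measurable_id
    rw [hcR, ← setIntegral_preimage_eq μ ((hZ _).const_mul _) hA,
      ← hM.setIntegral_eq (mul_le_of_le_one_left' hr1) (hY hA), setIntegral_preimage_eq μ ((hZ _).const_mul _) hA]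
    have h1 := hss.integral_scale hZ hc0 (r * t) hfx
    rw [hct] at h1
    rw [← h1, hrκ]
    simp_rw [mul_left_comm _ ((c : ℝ) ^ κ)]
    rw [integral_const_mul, ← mul_assoc, mul_right_comm _ _ ((r : ℝ) ^ κ)]
    suffices h : ((t : ℝ) / s) ^ κ * (c : ℝ) ^ κ * (r : ℝ) ^ κ = 1 by
      linear_combination (-∫ ω, A.indicator 1 ((c : ℝ) ^ κ * Z (r * t) ω) * Z (r * t) ω ∂μ) * h
    rw [← Real.mul_rpow (by positivity) (by positivity),
      ← Real.mul_rpow (by positivity) (by positivity), ← hcR]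
    rw [show (t : ℝ) / s * (s / (t * r)) * r = 1 by
      have : (r : ℝ) ≠ 0 := (NNReal.coe_pos.2 hr0).ne'
      field_simp]
    exact Real.one_rpow _
  have hpt : Integrable (fun p : Ω × ℝ => f ((s : ℝ) ^ κ * lamperti κ Z (Real.log t - p.2) p.1)
      * ((t : ℝ) ^ κ * lamperti κ Z (Real.log t) p.1))
      (μ.prod (ν.map (ζ a))) := by
    refine Integrable.bdd_mul (c := 1) ?_ (hfm.comp hr.fst).aestronglyMeasurable
      (ae_of_all _ fun p => hf1 _)
    simp_rw [rpow_mul_lamperti_log ht]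
    exact (hM.integrable t).comp_fst _
  rw [setIntegral_preimage_eq μ' (hX s) hA, setIntegral_preimage_eq μ' (hX s) hA,
    ← integral_map (f := fun x : ℝ × ℝ => f x.1 * x.2) ((hX s).prodMk (hX t)).aemeasurable
      hH.aestronglyMeasurable, hpair, integral_map hr.aemeasurable hH.aestronglyMeasurable,
    integral_prod_symm _ hpt, integral_map (hζ.measurable a).aemeasurable]
  · simp_rw [hinner]
    rw [integral_const_mul, hκζ, haR,
      integral_of_map_eq hX hZ (hmarg s) (f := fun x => f x * x) (hfm.mul measurable_id)]
    rw [mul_right_comm, show -((Real.log t - Real.log s) * κ) = -(Real.log (t / s) * κ) by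
      rw [Real.log_div ht'.ne' hs'.ne'], Real.exp_neg, ← Real.rpow_def_of_pos (by positivity),
      mul_inv_cancel₀ (by positivity), one_mul]
  · exact (hpt.1.prod_swap.integral_prod_right')

/-- A Markov process started at `0` with the two-dimensional laws of the subordinated process is a
martingale. -/
theorem martingale_of_setIntegral_eq (hX : ∀ t, Measurable (X t)) (hX0 : ∀ p, X 0 p = 0)
    (hi : ∀ t, Integrable (X t) μ') (hz : ∀ t, ∫ p, X t p ∂μ' = 0)
    (hK : ∀ s t : ℝ≥0, 0 < s → s ≤ t → μ'[X t | naturalFiltration X hX s]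
      =ᵐ[μ'] μ'[X t | MeasurableSpace.comap (X s) inferInstance])
    (hint : ∀ s t : ℝ≥0, 0 < s → s ≤ t → ∀ A, MeasurableSet A →
      ∫ p in X s ⁻¹' A, X t p ∂μ' = ∫ p in X s ⁻¹' A, X s p ∂μ') :
    Martingale X (naturalFiltration X hX) μ' := by
  refine ⟨Filtration.stronglyAdapted_natural _, fun s t hst => ?_⟩
  rcases eq_or_ne s 0 with rfl | hs
  -- The start is deterministic, so conditioning at time `0` is taking the mean.
  · have hF : (naturalFiltration X hX 0 : MeasurableSpace Ω') = ⊥ := by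
      refine le_bot_iff.1 (iSup₂_le fun j hj => ?_)
      obtain rfl : j = 0 := le_antisymm hj bot_le
      rw [show X 0 = fun _ => 0 from funext hX0, MeasurableSpace.comap_const]
    rw [hF, condExp_bot, hz, show X 0 = fun _ => 0 from funext hX0]
  · have hs := pos_iff_ne_zero.2 hs
    refine (hK s t hs hst).trans (ae_eq_condExp_of_forall_setIntegral_eq (hX s).comap_le (hi t)
      (fun _ _ _ => (hi s).integrableOn) ?_ ?_).symm
    · rintro _ ⟨A, hA, rfl⟩ -
      exact (hint s t hs hst A hA).symm
    · exact (comap_measurable (X s)).stronglyMeasurable.aestronglyMeasurable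

end

/-! ### Versions of the subordinated process -/

theorem naturalFiltration_zero {Ω : Type*} [MeasurableSpace Ω] {X : ℝ≥0 → Ω → ℝ}
    (hX : ∀ t, Measurable (X t)) :
    (naturalFiltration X hX 0 : MeasurableSpace Ω) = MeasurableSpace.comap (X 0) inferInstance := by
  refine le_antisymm (iSup₂_le fun j hj => ?_) (le_iSup₂_of_le 0 le_rfl le_rfl)
  obtain rfl : j = 0 := le_antisymm hj bot_le
  exact le_rfl

section

variable {Ω Ω₂ : Type*} [MeasurableSpace Ω] [MeasurableSpace Ω₂] {μ : Measure Ω}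
  [IsProbabilityMeasure μ] {ρ : Measure Ω₂} [IsProbabilityMeasure ρ] {V : ℝ → Ω → ℝ}
  {η : ℝ → Ω₂ → ℝ} {Q : Kernel (ℝ × ℝ) ℝ} [IsMarkovKernel Q] {m : ℝ → Measure ℝ} {κ : ℝ}
  {X : ℝ≥0 → Ω × Ω₂ → ℝ}

/-- The Markov property of a version of the subordinated process, for all integrable functions. -/
theorem condExp_naturalFiltration_of_ae_eq_lampertiInv (hV : IsStationaryMarkov μ V Q)
    (hη : IsTwoSidedSubordinator ρ η m) (hX : ∀ t, Measurable (X t))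
    (hae : ∀ᵐ p ∂(μ.prod ρ), ∀ t, X t p = lampertiInv κ (subordinate V η) t p) {s t : ℝ≥0}
    (hst : s ≤ t) {g : ℝ → ℝ} (hg : Measurable g)
    (hi : Integrable (fun p => g (X t p)) (μ.prod ρ)) :
    (μ.prod ρ)[fun p => g (X t p) | naturalFiltration X hX s] =ᵐ[μ.prod ρ]
      (μ.prod ρ)[fun p => g (X t p) | MeasurableSpace.comap (X s) inferInstance] := by
  rcases eq_or_ne s 0 with rfl | hs
  · rw [naturalFiltration_zero]
  · obtain ⟨K, hK, h⟩ := exists_kernel_lampertiInv (κ := κ) hV hη (pos_iff_ne_zero.2 hs) hst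
    refine condExp_naturalFiltration_ae_eq_of_kernel hX s t K ?_ hg hi
    -- One null set serves all times, so whole paths agree almost surely and their laws coincide.
    have h1 : (fun p => (fun c : Iic s => X c p, X t p)) =ᵐ[μ.prod ρ]
        fun p => (fun c : Iic s => lampertiInv κ (subordinate V η) c p,
          lampertiInv κ (subordinate V η) t p) := by
      filter_upwards [hae] with p hp
      simp only [hp]
    have h2 : (fun p (c : Iic s) => X c p) =ᵐ[μ.prod ρ]
        fun p (c : Iic s) => lampertiInv κ (subordinate V η) c p := by
      filter_upwards [hae] with p hp
      simp only [hp]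
    rw [Measure.map_congr h1, Measure.map_congr h2, h]

theorem isMarkovProcess_of_ae_eq_lampertiInv (hV : IsStationaryMarkov μ V Q)
    (hη : IsTwoSidedSubordinator ρ η m) (hX : ∀ t, Measurable (X t))
    (hae : ∀ᵐ p ∂(μ.prod ρ), ∀ t, X t p = lampertiInv κ (subordinate V η) t p) :
    IsMarkovProcess (μ.prod ρ) X hX := by
  rintro s t hst g hg ⟨C, hC⟩
  exact condExp_naturalFiltration_of_ae_eq_lampertiInv hV hη hX hae hst hg
    (.of_bound (hg.comp (hX t)).aestronglyMeasurable C (ae_of_all _ fun p => hC _))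

theorem isSelfSimilar_of_ae_eq_lampertiInv (hV : IsStationaryMarkov μ V Q)
    (hη : IsTwoSidedSubordinator ρ η m)
    (hae : ∀ᵐ p ∂(μ.prod ρ), ∀ t, X t p = lampertiInv κ (subordinate V η) t p) :
    IsSelfSimilar κ (μ.prod ρ) X := by
  intro c hc I
  have hY := measurable_lampertiInv (κ := κ) (measurable_subordinate hV hη)
  have hI : Measurable fun (z : ℝ≥0 → ℝ) (i : I) => z i :=
    measurable_pi_lambda _ fun i => measurable_pi_apply _
  have key := congrArg (Measure.map fun (z : ℝ≥0 → ℝ) (i : I) => z i)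
    (map_lampertiInv_scale (κ := κ) hV hη hc)
  rw [Measure.map_map hI (measurable_pi_lambda _ fun _ => hY _),
    Measure.map_map hI (measurable_pi_lambda _ fun _ => (hY _).const_mul _)] at key
  have h1 : (fun p (i : I) => X (c * i) p) =ᵐ[μ.prod ρ]
      fun p (i : I) => lampertiInv κ (subordinate V η) (c * i) p := by
    filter_upwards [hae] with p hp
    simp only [hp]
  have h2 : (fun p (i : I) => (c : ℝ) ^ κ * X i p) =ᵐ[μ.prod ρ]
      fun p (i : I) => (c : ℝ) ^ κ * lampertiInv κ (subordinate V η) i p := by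
    filter_upwards [hae] with p hp
    simp only [hp]
  rw [Measure.map_congr h1, Measure.map_congr h2]
  exact key

end

section

variable {Ω Ω₁ : Type*} [MeasurableSpace Ω] [MeasurableSpace Ω₁] {μ : Measure Ω}
  [IsProbabilityMeasure μ] {ν : Measure Ω₁} [IsProbabilityMeasure ν] {κ : ℝ} {Z : ℝ≥0 → Ω → ℝ}
  {ζ : ℝ≥0 → Ω₁ → ℝ}

/-- A version of the subordinated process inherits the martingale property. -/
theorem martingale_of_ae_eq_lampertiInv {Q : Kernel (ℝ × ℝ) ℝ} [IsMarkovKernel Q]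
    (hκ : 0 < κ) (hZ : ∀ t, Measurable (Z t)) (hss : IsSelfSimilar κ μ Z)
    (hZj : Measurable fun p : ℝ≥0 × Ω => Z p.1 p.2) (hV : IsStationaryMarkov μ (lamperti κ Z) Q)
    (hζ : IsSubordinator ν ζ)
    (hκζ : ∀ a : ℝ≥0, ∫ ω, Real.exp (-(κ * ζ a ω)) ∂ν = Real.exp (-(a * κ)))
    (hM : Martingale Z (naturalFiltration Z hZ) μ) {X : ℝ≥0 → Ω × (Ω₁ × Ω₁) → ℝ}
    (hX : ∀ t, Measurable (X t)) (hX0 : ∀ p, X 0 p = 0)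
    (hae : ∀ᵐ p ∂(μ.prod (ν.prod ν)), ∀ t,
      X t p = lampertiInv κ (subordinate (lamperti κ Z) (twoSided ζ)) t p) :
    Martingale X (naturalFiltration X hX) (μ.prod (ν.prod ν)) := by
  have hη := hζ.isTwoSidedSubordinator
  have hmarg : ∀ t, (μ.prod (ν.prod ν)).map (X t) = μ.map (Z t) := fun t => by
    rw [Measure.map_congr (hae.mono fun p hp => hp t), map_lampertiInv hκ hZ hss hV hη]
  have hi : ∀ t, Integrable (X t) (μ.prod (ν.prod ν)) := fun t =>
    integrable_of_map_eq hX hZ (hmarg t) (hM.integrable t)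
  refine martingale_of_setIntegral_eq hX hX0 hi (fun t => ?_) (fun s t _ hst => ?_)
    fun s t hs hst A hA => ?_
  -- The mean of `Z_t` is that of `Z_0`, which vanishes almost surely.
  · have h0 := hM.setIntegral_eq (i := 0) (j := t) bot_le MeasurableSet.univ
    rw [integral_of_map_eq hX hZ (hmarg t) (f := fun x => x) measurable_id]
    rw [setIntegral_univ, setIntegral_univ] at h0
    rw [← h0, integral_congr_ae (hss.zero_ae_eq_zero hκ hZ)]
    simp
  · exact condExp_naturalFiltration_of_ae_eq_lampertiInv hV hη hX hae hst measurable_id (hi t)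
  · refine setIntegral_eq_of_map_prodMk hX hZ hZj hss hζ hκζ hmarg hM hs hst ?_ hA
    rw [Measure.map_congr (hae.mono fun p hp => by rw [hp s, hp t]),
      map_lampertiInv_prodMk hV hη hs hst]

/-- By scaling, `E|Z_t| = t^κ E|Z_1|`. -/
theorem tendsto_integral_abs_of_isSelfSimilar (hκ : 0 < κ) (hZ : ∀ t, Measurable (Z t))
    (hss : IsSelfSimilar κ μ Z) : Tendsto (fun t => ∫ ω, |Z t ω| ∂μ) (𝓝[>] 0) (𝓝 0) := by
  have h : Tendsto (fun t : ℝ≥0 => (t : ℝ) ^ κ * ∫ ω, |Z 1 ω| ∂μ) (𝓝[>] 0) (𝓝 0) := by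
    have h1 : Tendsto (fun t : ℝ≥0 => (t : ℝ) ^ κ) (𝓝 0) (𝓝 0) := by
      have := (NNReal.continuous_coe.rpow_const fun _ => Or.inr hκ.le).tendsto (0 : ℝ≥0)
      simpa [Real.zero_rpow hκ.ne'] using this
    simpa using (h1.mono_left nhdsWithin_le_nhds).mul_const (∫ ω, |Z 1 ω| ∂μ)
  refine h.congr' ?_
  filter_upwards [self_mem_nhdsWithin] with t ht
  have := hss.integral_scale hZ ht 1 (f := fun x => |x|) measurable_id.abs
  rw [mul_one] at this
  rw [← this]
  simp_rw [abs_mul]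
  rw [integral_const_mul, abs_of_nonneg (Real.rpow_nonneg t.coe_nonneg _)]

/-- A process that is càdlàg away from `0` and almost surely tends to `0` at time `0` has a version
which is càdlàg. -/
theorem exists_version_isCadlagAt {Ω : Type*} [MeasurableSpace Ω] {μ : Measure Ω}
    {Y : ℝ≥0 → Ω → ℝ} (hY : ∀ t, Measurable (Y t)) (hY0 : ∀ ω, Y 0 ω = 0)
    (hc : ∀ ω t, 0 < t → IsCadlagAt (fun t => Y t ω) t)
    (hlim : ∀ᵐ ω ∂μ, Tendsto (fun t => Y t ω) (𝓝[>] 0) (𝓝 0)) :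
    ∃ X : ℝ≥0 → Ω → ℝ, (∀ t, Measurable (X t)) ∧ (∀ ω, X 0 ω = 0) ∧
      (∀ ω t, IsCadlagAt (fun t => X t ω) t) ∧ ∀ᵐ ω ∂μ, ∀ t, X t ω = Y t ω := by
  classical
  -- The paths in a measurable null set containing all failures are replaced by the zero path.
  obtain ⟨N, hN, hNm, hN0⟩ := exists_measurable_superset_of_null (ae_iff.1 hlim)
  refine ⟨fun t => Nᶜ.indicator (Y t), fun t => (hY t).indicator hNm.compl, fun ω => ?_,
    fun ω t => ?_, ?_⟩
  · by_cases hω : ω ∈ N <;> simp [hω, hY0]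
  · by_cases hω : ω ∈ N
    · have : (fun t => Nᶜ.indicator (Y t) ω) = fun _ => 0 := by
        funext t; simp [hω]
      rw [this]
      exact ⟨continuousWithinAt_const, 0, tendsto_const_nhds⟩
    · have : (fun t => Nᶜ.indicator (Y t) ω) = fun t => Y t ω := by
        funext t; simp [hω]
      rw [this]
      rcases eq_or_ne t 0 with rfl | ht
      · refine ⟨?_, 0, by simp⟩
        rw [← continuousWithinAt_Ioi_iff_Ici]
        have hω' : Tendsto (fun t => Y t ω) (𝓝[>] 0) (𝓝 0) := by
          by_contra hcon
          exact hω (hN hcon)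
        simpa [ContinuousWithinAt, hY0] using hω'
      · exact hc ω t (pos_iff_ne_zero.2 ht)
  · filter_upwards [measure_eq_zero_iff_ae_notMem.1 hN0] with ω hω t
    simp [hω]

end

/-! ### Assembling the theorem -/

theorem mainTheorem1 {Ω : Type u} [MeasurableSpace Ω] (μ : Measure Ω) [IsProbabilityMeasure μ]
    (κ : ℝ) (hκ : 0 < κ)
    (Z : ℝ≥0 → Ω → ℝ) (hZ : ∀ t, Measurable (Z t))
    (hZcadlag : ∀ ω t, IsCadlagAt (fun t => Z t ω) t)
    (hZss : IsSelfSimilar κ μ Z) (hZmarkov : IsMarkovProcess μ Z hZ)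
    (ψ : ℝ → ℝ) (hψ : IsLaplaceExponent ψ) :
    ∃ G : ℝ≥0 → Measure ℝ≥0, IsRandomisingFamily ψ G ∧
      -- the two forms of the martingale condition
      (ψ κ = κ ↔ ∀ s t : ℝ≥0, 0 < s → s ≤ t →
        ∫ r : ℝ≥0, (r : ℝ) ^ κ ∂(G (t / s)) = ((s : ℝ) / t) ^ κ) ∧
      ∃ (Ω' : Type u) (_ : MeasurableSpace Ω') (μ' : Measure Ω') (_ : IsProbabilityMeasure μ')
        (X : ℝ≥0 → Ω' → ℝ) (hX : ∀ t, Measurable (X t)),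
        -- a self-similar Markov process from `0` with the marginals of `Z`
        IsMarkovProcess μ' X hX ∧ IsSelfSimilar κ μ' X ∧
        (∀ ω, X 0 ω = 0) ∧ (∀ t, μ'.map (X t) = μ.map (Z t)) ∧
        (∀ ω t, 0 < t → IsCadlagAt (fun t => X t ω) t) ∧
        -- its transition function is the randomisation of that of `Z`
        (∀ P : ℝ≥0 → ℝ≥0 → ℝ → Measure ℝ, IsTransitionFunctionOf μ Z P →
          IsTransitionFunctionOf μ' X (randomisedTransition κ G P) ∧
          (IsScalingTransitionSystem κ P →
            IsScalingTransitionSystem κ (randomisedTransition κ G P))) ∧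
        -- the martingale property
        (Martingale Z (naturalFiltration Z hZ) μ → ψ κ = κ →
          Martingale X (naturalFiltration X hX) μ' ∧
          ∀ ω t, IsCadlagAt (fun t => X t ω) t) := by

  obtain ⟨Ω₁, _, ν, _, ζ, hζ, hLap⟩ := hψ
  have hZj := measurable_uncurry_of_rightContinuous hZ fun ω t => (hZcadlag ω t).1
  obtain ⟨Q, _, hV⟩ := exists_isStationaryMarkov_lamperti hZ hZj hZmarkov hZss
  have hη := hζ.isTwoSidedSubordinator
  have hfam := hζ.isRandomisingFamily hLap
  refine ⟨fun u => ν.map (randomFactor ζ u), hfam, hfam.martingale_condition_iff hκ,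
    Ω × (Ω₁ × Ω₁), inferInstance, μ.prod (ν.prod ν), inferInstance, ?_⟩
  set Y := lampertiInv κ (subordinate (lamperti κ Z) (twoSided ζ)) with hYdef
  have hY : ∀ t, Measurable (Y t) := measurable_lampertiInv (measurable_subordinate hV hη)
  have hY0 : ∀ p, Y 0 p = 0 := fun p => by simp [hYdef, lampertiInv]
  have hYc : ∀ p t, 0 < t → IsCadlagAt (fun t => Y t p) t := fun p t ht =>
    isCadlagAt_lampertiInv_subordinate hZcadlag hζ.monotone_twoSided
      hζ.rightContinuous_twoSided p ht
  have hmart : ∀ X : ℝ≥0 → Ω × (Ω₁ × Ω₁) → ℝ, ∀ hX : ∀ t, Measurable (X t), (∀ p, X 0 p = 0) →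
      (∀ᵐ p ∂(μ.prod (ν.prod ν)), ∀ t, X t p = Y t p) →
      Martingale Z (naturalFiltration Z hZ) μ → ψ κ = κ →
      Martingale X (naturalFiltration X hX) (μ.prod (ν.prod ν)) :=
    fun X hX hX0 hae hM hψκ => martingale_of_ae_eq_lampertiInv hκ hZ hZss hZj hV hζ
      (fun a => by rw [hLap a κ hκ.le, hψκ]) hM hX hX0 hae
  obtain ⟨X, hX, hX0, hXc, hXm, hae⟩ : ∃ X : ℝ≥0 → Ω × (Ω₁ × Ω₁) → ℝ, (∀ t, Measurable (X t)) ∧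
      (∀ p, X 0 p = 0) ∧ (∀ p t, 0 < t → IsCadlagAt (fun t => X t p) t) ∧
      (Martingale Z (naturalFiltration Z hZ) μ → ψ κ = κ →
        ∀ p t, IsCadlagAt (fun t => X t p) t) ∧
      ∀ᵐ p ∂(μ.prod (ν.prod ν)), ∀ t, X t p = Y t p := by
    -- One process must serve every claim, so the version is chosen according to whether the
    -- martingale hypotheses hold; otherwise `Y` itself is kept and nothing is asserted at time `0`.
    by_cases hM : Martingale Z (naturalFiltration Z hZ) μ ∧ ψ κ = κ
    · have hYM := hmart Y hY hY0 (ae_of_all _ fun _ _ => rfl) hM.1 hM.2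
      have h0 : Tendsto (fun t => ∫ p, |Y t p| ∂(μ.prod (ν.prod ν))) (𝓝[>] 0) (𝓝 0) :=
        (tendsto_integral_abs_of_isSelfSimilar hκ hZ hZss).congr fun t =>
          (integral_of_map_eq hY hZ (map_lampertiInv hκ hZ hZss hV hη t) (f := fun x => |x|)
            measurable_id.abs).symm
      obtain ⟨X, h1, h2, h3, h4⟩ := exists_version_isCadlagAt hY hY0 hYc
        (hYM.ae_tendsto_zero (fun p t ht => (hYc p t ht).1) h0)
      exact ⟨X, h1, h2, fun p t _ => h3 p t, fun _ _ => h3, h4⟩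
    · exact ⟨Y, hY, hY0, hYc, fun h1 h2 => absurd ⟨h1, h2⟩ hM, ae_of_all _ fun _ _ => rfl⟩
  have hmarg : ∀ t, (μ.prod (ν.prod ν)).map (X t) = μ.map (Z t) := fun t => by
    rw [Measure.map_congr (hae.mono fun p hp => hp t), map_lampertiInv hκ hZ hZss hV hη]
  refine ⟨X, hX, isMarkovProcess_of_ae_eq_lampertiInv hV hη hX hae,
    isSelfSimilar_of_ae_eq_lampertiInv hV hη hae, hX0, hmarg, hXc, fun P hP => ⟨?_, fun hS => ?_⟩,
    fun hM hψκ => ⟨hmart X hX hX0 hae hM hψκ, hXm hM hψκ⟩⟩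
  · refine hP.randomised hX hX0 hκ hZ hZj hZss hζ hmarg fun s t hs hst h => ?_
    rw [Measure.map_congr (hae.mono fun p hp => by rw [hp s, hp t]),
      map_lampertiInv_prodMk hV hη hs hst]
  · exact hS.randomised hζ hP.measurable hP.isProbabilityMeasure
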